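/- All C*-algebras are complex and not necessarily unital. For a C*-algebra $A$, let $\widetilde A$ denote its minimal unitisation: $\widetilde A = A$ if $A$ has a unit, and $\widetilde A = A \oplus \mathbb{C}1$ is obtained by adjoining a unit otherwise. Let $\otimes$ denote the spatial (minimal) tensor product of C*-algebras. Recall the following notions. - $A$ is *stably finite* if for every $n \in \mathbb{N}$ the C*-algebra $M_n(\widetilde A)$ contains no non-unitary isometry, i.e. every $v \in M_n(\widetilde A)$ with $v^*v = 1$ satisfies $vv^* = 1$. - $A$ is *exact* if for every short exact sequence $0 \to J \to D \to E \to 0$ of C*-algebras the sequence $0 \to A\otimes J \to A \otimes D \to A \otimes E \to 0$ is exact. - A separable C*-algebra $B$ is *MF* if there is a sequence $(k_i)_{i\in\mathbb{N}}$ in $\mathbb{N}$ such that $B$ embeds (by an injective $*$-homomorphism) into $\prod_{i} M_{k_i}(\mathbb{C}) \big/ \bigoplus_{i} M_{k_i}(\mathbb{C})$, where $\prod_i M_{k_i}(\mathbb{C})$ is the C*-algebra of bounded sequences and $\bigoplus_i M_{k_i}(\mathbb{C})$ is the ideal of sequences converging to $0$ in norm. **Lemma.** Let $A$ be an exact, stably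 finite C*-algebra and let $B$ be a separable, MF C*-algebra. Then the spatial tensor product $A \otimes B$ is stably finite. -/

import Mathlib

open scoped ENNReal TensorProduct ComplexOrder

universe u v w

noncomputable section

/-! ### Stable finiteness -/

/-- `e` is a two-sided unit of the (possibly non-unital) C⋆-algebra `A`. -/
def IsCStarUnit {A : Type u} [NonUnitalCStarAlgebra A] (e : A) : Prop :=
  ∀ a : A, e * a = a ∧ a * e = a

/-- A C⋆-algebra `A` is stably finite if no matrix algebra `M_n(Ã)` over its minimal unitisation
`Ã` contains a non-unitary isometry. The minimal unitisation is `A` itself if `A` has a unit `e`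
(so that the unit of `M_n(A)` is the diagonal matrix with entries `e`), and it is the algebra
`A ⊕ ℂ` obtained by adjoining a unit if `A` has no unit. -/
def IsStablyFinite (A : Type u) [NonUnitalCStarAlgebra A] : Prop :=
  (∀ e : A, IsCStarUnit e → ∀ (n : ℕ) (v : Matrix (Fin n) (Fin n) A),
    v.conjTranspose * v = Matrix.diagonal (fun _ => e) →
      v * v.conjTranspose = Matrix.diagonal (fun _ => e)) ∧
  ((¬ ∃ e : A, IsCStarUnit e) → ∀ (n : ℕ) (v : Matrix (Fin n) (Fin n) (Unitization ℂ A)),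
    v.conjTranspose * v = 1 → v * v.conjTranspose = 1)

/-! ### The spatial tensor product -/

/-- A ⋆-representation of the C⋆-algebra `A` on a Hilbert space. -/
structure CStarRep (A : Type u) [NonUnitalCStarAlgebra A] : Type (u + 1) where
  /-- The Hilbert space of the representation. -/
  H : Type u
  [instNorm : NormedAddCommGroup H]
  [instInner : InnerProductSpace ℂ H]
  [instComplete : CompleteSpace H]
  /-- The ⋆-homomorphism into the bounded operators. -/
  hom : A →⋆ₙₐ[ℂ] (H →L[ℂ] H)

attribute [instance] CStarRep.instNorm CStarRep.instInner CStarRep.instComplete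

/-- The pullback of a representation along a ⋆-homomorphism. -/
def CStarRep.comp {A B : Type u} [NonUnitalCStarAlgebra A] [NonUnitalCStarAlgebra B]
    (π : CStarRep B) (φ : A →⋆ₙₐ[ℂ] B) : CStarRep A where
  H := π.H
  hom := π.hom.comp φ

/-- The Hilbert space tensor product of `H` and `K`: the completion of the algebraic one. -/
def HilbertTensor (H : Type u) (K : Type v) [NormedAddCommGroup H] [InnerProductSpace ℂ H]
    [NormedAddCommGroup K] [InnerProductSpace ℂ K] : Type (max u v) :=
  UniformSpace.Completion (H ⊗[ℂ] K)

section HilbertTensor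

variable (H : Type u) (K : Type v) [NormedAddCommGroup H] [InnerProductSpace ℂ H]
  [NormedAddCommGroup K] [InnerProductSpace ℂ K]

instance HilbertTensor.instNormedAddCommGroup : NormedAddCommGroup (HilbertTensor H K) :=
  inferInstanceAs (NormedAddCommGroup (UniformSpace.Completion (H ⊗[ℂ] K)))

instance HilbertTensor.instInnerProductSpace : InnerProductSpace ℂ (HilbertTensor H K) :=
  inferInstanceAs (InnerProductSpace ℂ (UniformSpace.Completion (H ⊗[ℂ] K)))

instance HilbertTensor.instCompleteSpace : CompleteSpace (HilbertTensor H K) :=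
  inferInstanceAs (CompleteSpace (UniformSpace.Completion (H ⊗[ℂ] K)))

variable {H K}

/-- The operator `S ⊗ T` on the Hilbert space tensor product of `H` and `K`, determined by
`(S ⊗ T) (ξ ⊗ η) = S ξ ⊗ T η`. -/
def opTensor (S : H →L[ℂ] H) (T : K →L[ℂ] K) : HilbertTensor H K →L[ℂ] HilbertTensor H K :=
  (TensorProduct.mapL S T).completion

lemma norm_opTensor_le (S : H →L[ℂ] H) (T : K →L[ℂ] K) : ‖opTensor S T‖ ≤ ‖S‖ * ‖T‖ := by
  refine ContinuousLinearMap.opNorm_le_bound _ (by positivity) fun x => ?_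
  induction x using UniformSpace.Completion.induction_on with
  | hp =>
    exact isClosed_le (continuous_norm.comp (opTensor S T).continuous)
      (continuous_const.mul continuous_norm)
  | ih x =>
    have h1 : opTensor S T (x : UniformSpace.Completion (H ⊗[ℂ] K)) =
        ((TensorProduct.mapL S T x : H ⊗[ℂ] K) : UniformSpace.Completion (H ⊗[ℂ] K)) :=
      ContinuousLinearMap.completion_apply_coe _ x
    rw [h1]
    change ‖((TensorProduct.mapL S T x : H ⊗[ℂ] K) : UniformSpace.Completion (H ⊗[ℂ] K))‖ ≤
      ‖S‖ * ‖T‖ * ‖(x : UniformSpace.Completion (H ⊗[ℂ] K))‖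
    rw [UniformSpace.Completion.norm_coe, UniformSpace.Completion.norm_coe]
    exact ((TensorProduct.mapL S T).le_opNorm x).trans
      (mul_le_mul_of_nonneg_right (TensorProduct.norm_mapL_le S T) (norm_nonneg x))

end HilbertTensor

/-- The C⋆-algebra of all bounded families of operators on the Hilbert spaces `H_π ⊗ K_σ`, where
`π` and `σ` run through all representations of `A` and `B`. -/
def RepProd (A : Type u) (B : Type v) [NonUnitalCStarAlgebra A] [NonUnitalCStarAlgebra B] :
    Type (max (u + 1) (v + 1)) :=
  lp (fun p : CStarRep A × CStarRep B =>
    HilbertTensor p.1.H p.2.H →L[ℂ] HilbertTensor p.1.H p.2.H) ∞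

instance RepProd.instNonUnitalCStarAlgebra (A : Type u) (B : Type v) [NonUnitalCStarAlgebra A]
    [NonUnitalCStarAlgebra B] : NonUnitalCStarAlgebra (RepProd A B) :=
  inferInstanceAs (NonUnitalCStarAlgebra (lp (fun p : CStarRep A × CStarRep B =>
    HilbertTensor p.1.H p.2.H →L[ℂ] HilbertTensor p.1.H p.2.H) ∞))

/-- The family `(π(a) ⊗ σ(b))_{π, σ}`. -/
def repTensor {A : Type u} {B : Type v} [NonUnitalCStarAlgebra A] [NonUnitalCStarAlgebra B]
    (a : A) (b : B) : RepProd A B :=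
  ⟨fun p => opTensor (p.1.hom a) (p.2.hom b), by
    refine memℓp_infty ⟨‖a‖ * ‖b‖, ?_⟩
    rintro _ ⟨p, rfl⟩
    exact (norm_opTensor_le _ _).trans (mul_le_mul (NonUnitalStarAlgHom.norm_apply_le p.1.hom a)
      (NonUnitalStarAlgHom.norm_apply_le p.2.hom b) (norm_nonneg _) (norm_nonneg _))⟩

/-- The spatial tensor product as a C⋆-subalgebra of `RepProd A B`: the one generated by all
elementary tensors. It is the completion of the algebraic tensor product in the spatial norm
`‖x‖ = sup_{π, σ} ‖(π ⊗ σ) x‖`. -/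
def spatialSubalgebra (A : Type u) (B : Type v) [NonUnitalCStarAlgebra A]
    [NonUnitalCStarAlgebra B] : NonUnitalStarSubalgebra ℂ (RepProd A B) :=
  (NonUnitalStarAlgebra.adjoin ℂ
    (Set.range fun p : A × B => repTensor p.1 p.2)).topologicalClosure

/-- The spatial (minimal) tensor product of the C⋆-algebras `A` and `B`. -/
abbrev SpatialTensor (A : Type u) (B : Type v) [NonUnitalCStarAlgebra A]
    [NonUnitalCStarAlgebra B] : Type (max (u + 1) (v + 1)) :=
  spatialSubalgebra A B

instance SpatialTensor.instNonUnitalCStarAlgebra (A : Type u) (B : Type v)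
    [NonUnitalCStarAlgebra A] [NonUnitalCStarAlgebra B] :
    NonUnitalCStarAlgebra (SpatialTensor A B) :=
  NonUnitalStarSubalgebra.nonUnitalCStarAlgebra (spatialSubalgebra A B)
    (h_closed := NonUnitalStarSubalgebra.isClosed_topologicalClosure _)

/-- The elementary tensor `a ⊗ b` in the spatial tensor product. -/
def SpatialTensor.tmul {A : Type u} {B : Type v} [NonUnitalCStarAlgebra A]
    [NonUnitalCStarAlgebra B] (a : A) (b : B) : SpatialTensor A B :=
  ⟨repTensor a b, NonUnitalStarSubalgebra.le_topologicalClosure _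
    (NonUnitalStarAlgebra.subset_adjoin ℂ _ ⟨(a, b), rfl⟩)⟩

/-- Reindexing of families of operators along `ψ` and `φ`. -/
def RepProd.map {A A' : Type u} {B B' : Type v} [NonUnitalCStarAlgebra A]
    [NonUnitalCStarAlgebra A'] [NonUnitalCStarAlgebra B] [NonUnitalCStarAlgebra B']
    (ψ : A →⋆ₙₐ[ℂ] A') (φ : B →⋆ₙₐ[ℂ] B') : RepProd A B →⋆ₙₐ[ℂ] RepProd A' B' where
  toFun x := ⟨fun p => x.1 (p.1.comp ψ, p.2.comp φ), by
    obtain ⟨C, hC⟩ := memℓp_infty_iff.1 x.2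
    refine memℓp_infty ⟨C, ?_⟩
    rintro _ ⟨p, rfl⟩
    exact hC ⟨(p.1.comp ψ, p.2.comp φ), rfl⟩⟩
  map_smul' _ _ := rfl
  map_zero' := rfl
  map_add' _ _ := rfl
  map_mul' _ _ := rfl
  map_star' _ := rfl

lemma RepProd.map_mem {A A' : Type u} {B B' : Type v} [NonUnitalCStarAlgebra A]
    [NonUnitalCStarAlgebra A'] [NonUnitalCStarAlgebra B] [NonUnitalCStarAlgebra B']
    (ψ : A →⋆ₙₐ[ℂ] A') (φ : B →⋆ₙₐ[ℂ] B') {x : RepProd A B} (hx : x ∈ spatialSubalgebra A B) :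
    RepProd.map ψ φ x ∈ spatialSubalgebra A' B' := by
  have hle : spatialSubalgebra A B ≤ (spatialSubalgebra A' B').comap (RepProd.map ψ φ) := by
    refine NonUnitalStarSubalgebra.topologicalClosure_minimal _
      (NonUnitalStarAlgebra.adjoin_le ?_) ?_
    · rintro _ ⟨p, rfl⟩
      exact NonUnitalStarSubalgebra.le_topologicalClosure _
        (NonUnitalStarAlgebra.subset_adjoin ℂ _ ⟨(ψ p.1, φ p.2), rfl⟩)
    · exact (NonUnitalStarSubalgebra.isClosed_topologicalClosure _).preimage
        (AddMonoidHomClass.continuous_of_bound (RepProd.map ψ φ) 1 fun y => by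
          simpa using NonUnitalStarAlgHom.norm_apply_le (RepProd.map ψ φ) y)
  exact hle hx

/-- The ⋆-homomorphism `ψ ⊗ φ` between spatial tensor products, determined by
`(ψ ⊗ φ) (a ⊗ b) = ψ a ⊗ φ b`. -/
def SpatialTensor.map {A A' : Type u} {B B' : Type v} [NonUnitalCStarAlgebra A]
    [NonUnitalCStarAlgebra A'] [NonUnitalCStarAlgebra B] [NonUnitalCStarAlgebra B']
    (ψ : A →⋆ₙₐ[ℂ] A') (φ : B →⋆ₙₐ[ℂ] B') : SpatialTensor A B →⋆ₙₐ[ℂ] SpatialTensor A' B' :=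
  NonUnitalStarAlgHom.codRestrict
    ((RepProd.map ψ φ).comp (NonUnitalStarSubalgebraClass.subtype (spatialSubalgebra A B)))
    (spatialSubalgebra A' B') (fun x => RepProd.map_mem ψ φ x.2)

lemma SpatialTensor.map_tmul {A A' : Type u} {B B' : Type v} [NonUnitalCStarAlgebra A]
    [NonUnitalCStarAlgebra A'] [NonUnitalCStarAlgebra B] [NonUnitalCStarAlgebra B']
    (ψ : A →⋆ₙₐ[ℂ] A') (φ : B →⋆ₙₐ[ℂ] B') (a : A) (b : B) :
    SpatialTensor.map ψ φ (SpatialTensor.tmul a b) = SpatialTensor.tmul (ψ a) (φ b) := rfl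

/-! ### Exactness -/

/-- A C⋆-algebra `A` is exact if `A ⊗ -` (spatial tensor product) turns every short exact sequence
`0 → J → D → E → 0` of C⋆-algebras into a short exact sequence. -/
def IsExactCStar (A : Type u) [NonUnitalCStarAlgebra A] : Prop :=
  ∀ (J D E : Type w) [NonUnitalCStarAlgebra J] [NonUnitalCStarAlgebra D] [NonUnitalCStarAlgebra E]
    (ι : J →⋆ₙₐ[ℂ] D) (φ : D →⋆ₙₐ[ℂ] E),
    Function.Injective ι → Function.Exact ι φ → Function.Surjective φ →
      Function.Injective (SpatialTensor.map (NonUnitalStarAlgHom.id ℂ A) ι) ∧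
      Function.Exact (SpatialTensor.map (NonUnitalStarAlgHom.id ℂ A) ι)
        (SpatialTensor.map (NonUnitalStarAlgHom.id ℂ A) φ) ∧
      Function.Surjective (SpatialTensor.map (NonUnitalStarAlgHom.id ℂ A) φ)

/-! ### MF algebras -/

section SeqQuotient

variable (M : ℕ → Type u) [∀ i, NonUnitalCStarAlgebra (M i)]

/-- The closed ideal `⨁ M_i` of the C⋆-algebra `∏ M_i` of bounded sequences: it consists of the
sequences that converge to zero in norm. -/
def nullSeq : Submodule ℂ (lp M ∞) where
  carrier := {x | Filter.Tendsto (fun i => ‖x i‖) Filter.atTop (nhds 0)}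
  zero_mem' := by simp
  add_mem' {x y} hx hy := by
    refine squeeze_zero (fun i => norm_nonneg _) (fun i => norm_add_le (x i) (y i)) ?_
    simpa using Filter.Tendsto.add hx hy
  smul_mem' c x hx := by
    have h : Filter.Tendsto (fun i => ‖c‖ * ‖x i‖) Filter.atTop (nhds 0) := by
      simpa using Filter.Tendsto.const_mul ‖c‖ hx
    simpa [norm_smul] using h

variable {M}

lemma mem_nullSeq {x : lp M ∞} :
    x ∈ nullSeq M ↔ ∀ ε > 0, ∃ n, ∀ i ≥ n, ‖x i‖ < ε := by
  change Filter.Tendsto (fun i => ‖x i‖) Filter.atTop (nhds 0) ↔ _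
  rw [Metric.tendsto_atTop]
  simp

lemma nullSeq_mul_left (a : lp M ∞) {x : lp M ∞} (hx : x ∈ nullSeq M) : a * x ∈ nullSeq M := by
  have hx' : Filter.Tendsto (fun i => ‖x i‖) Filter.atTop (nhds 0) := hx
  have h : Filter.Tendsto (fun i => ‖a‖ * ‖x i‖) Filter.atTop (nhds 0) := by
    simpa using hx'.const_mul ‖a‖
  refine squeeze_zero (fun i => norm_nonneg _) (fun i => ?_) h
  exact (norm_mul_le (a i) (x i)).trans (mul_le_mul_of_nonneg_right
    (lp.norm_apply_le_norm ENNReal.top_ne_zero a i) (norm_nonneg _))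

lemma nullSeq_star {x : lp M ∞} (hx : x ∈ nullSeq M) : star x ∈ nullSeq M := by
  have hx' : Filter.Tendsto (fun i => ‖x i‖) Filter.atTop (nhds 0) := hx
  refine squeeze_zero (fun i => norm_nonneg _) (fun i => ?_) hx'
  exact (norm_star (x i)).le

lemma nullSeq_mul_right (a : lp M ∞) {x : lp M ∞} (hx : x ∈ nullSeq M) : x * a ∈ nullSeq M := by
  simpa using nullSeq_star (nullSeq_mul_left (star a) (nullSeq_star hx))

instance nullSeq_isClosed : IsClosed (nullSeq M : Set (lp M ∞)) := by
  refine isClosed_of_closure_subset fun x hx => ?_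
  rw [SetLike.mem_coe, mem_nullSeq]
  intro ε hε
  obtain ⟨y, hy, hxy⟩ := Metric.mem_closure_iff.1 hx (ε / 2) (by positivity)
  obtain ⟨n, hn⟩ := mem_nullSeq.1 hy (ε / 2) (by positivity)
  refine ⟨n, fun i hi => ?_⟩
  have h1 : ‖(x - y) i‖ ≤ ‖x - y‖ := lp.norm_apply_le_norm ENNReal.top_ne_zero (x - y) i
  have h2 : ‖x i‖ ≤ ‖(x - y) i‖ + ‖y i‖ := by
    simpa using norm_add_le ((x - y) i) (y i)
  rw [dist_eq_norm] at hxy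
  linarith [hn i hi]

variable (M)

/-- The quotient C⋆-algebra `∏ M_i / ⨁ M_i`, with the quotient norm. -/
def SeqQuotient : Type u := lp M ∞ ⧸ nullSeq M

namespace SeqQuotient

instance instNormedAddCommGroup : NormedAddCommGroup (SeqQuotient M) :=
  inferInstanceAs (NormedAddCommGroup (lp M ∞ ⧸ nullSeq M))

instance instNormedSpace : NormedSpace ℂ (SeqQuotient M) :=
  inferInstanceAs (NormedSpace ℂ (lp M ∞ ⧸ nullSeq M))

instance instCompleteSpace : CompleteSpace (SeqQuotient M) :=
  inferInstanceAs (CompleteSpace (lp M ∞ ⧸ nullSeq M))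

/-- The quotient map `∏ M_i → ∏ M_i / ⨁ M_i`. -/
def mk : lp M ∞ →ₗ[ℂ] SeqQuotient M := (nullSeq M).mkQ

variable {M}

lemma mk_surjective : Function.Surjective (mk M) := (nullSeq M).mkQ_surjective

lemma mk_eq_mk {x y : lp M ∞} : mk M x = mk M y ↔ x - y ∈ nullSeq M :=
  Submodule.Quotient.eq (nullSeq M)

instance instMul : Mul (SeqQuotient M) where
  mul := Quotient.map₂ (· * ·) fun a a' ha b b' hb => by
    have ha' : a - a' ∈ nullSeq M := (nullSeq M).quotientRel_def.1 ha
    have hb' : b - b' ∈ nullSeq M := (nullSeq M).quotientRel_def.1 hb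
    refine (nullSeq M).quotientRel_def.2 ?_
    have h : a * b - a' * b' = (a - a') * b + a' * (b - b') := by
      rw [sub_mul, mul_sub]; abel
    rw [h]
    exact add_mem (nullSeq_mul_right b ha') (nullSeq_mul_left a' hb')

instance instStar : Star (SeqQuotient M) where
  star := Quotient.map star fun a a' ha => by
    have ha' : a - a' ∈ nullSeq M := (nullSeq M).quotientRel_def.1 ha
    refine (nullSeq M).quotientRel_def.2 ?_
    rw [← star_sub]
    exact nullSeq_star ha'

lemma mk_mul (a b : lp M ∞) : mk M (a * b) = mk M a * mk M b := rfl

lemma mk_star (a : lp M ∞) : mk M (star a) = star (mk M a) := rfl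

lemma norm_mk_le (a : lp M ∞) : ‖mk M a‖ ≤ ‖a‖ := Submodule.Quotient.norm_mk_le (nullSeq M) a

lemma exists_norm_lt (x : SeqQuotient M) {ε : ℝ} (hε : 0 < ε) :
    ∃ a : lp M ∞, mk M a = x ∧ ‖a‖ < ‖x‖ + ε :=
  Submodule.Quotient.norm_mk_lt x hε

instance instNonUnitalNormedRing : NonUnitalNormedRing (SeqQuotient M) where
  __ := instNormedAddCommGroup M
  __ := instMul
  left_distrib x y z := by
    obtain ⟨a, rfl⟩ := mk_surjective x
    obtain ⟨b, rfl⟩ := mk_surjective y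
    obtain ⟨c, rfl⟩ := mk_surjective z
    simp only [← map_add, ← mk_mul, mul_add]
  right_distrib x y z := by
    obtain ⟨a, rfl⟩ := mk_surjective x
    obtain ⟨b, rfl⟩ := mk_surjective y
    obtain ⟨c, rfl⟩ := mk_surjective z
    simp only [← map_add, ← mk_mul, add_mul]
  zero_mul x := by
    obtain ⟨a, rfl⟩ := mk_surjective x
    rw [← map_zero (mk M), ← mk_mul, zero_mul]
  mul_zero x := by
    obtain ⟨a, rfl⟩ := mk_surjective x
    rw [← map_zero (mk M), ← mk_mul, mul_zero]
  mul_assoc x y z := by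
    obtain ⟨a, rfl⟩ := mk_surjective x
    obtain ⟨b, rfl⟩ := mk_surjective y
    obtain ⟨c, rfl⟩ := mk_surjective z
    simp only [← mk_mul, mul_assoc]
  norm_mul_le x y := by
    refine le_of_forall_pos_le_add fun ε hε => ?_
    have hlim : Filter.Tendsto (fun δ : ℝ => (‖x‖ + δ) * (‖y‖ + δ))
        (nhdsWithin 0 (Set.Ioi 0)) (nhds (‖x‖ * ‖y‖)) := by
      have h : ContinuousAt (fun δ : ℝ => (‖x‖ + δ) * (‖y‖ + δ)) 0 := by fun_prop
      simpa using h.tendsto.mono_left nhdsWithin_le_nhds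
    have hle : ‖x * y‖ ≤ ‖x‖ * ‖y‖ := by
      refine ge_of_tendsto hlim ?_
      filter_upwards [self_mem_nhdsWithin] with δ hδ
      obtain ⟨a, rfl, ha⟩ := exists_norm_lt x hδ
      obtain ⟨b, rfl, hb⟩ := exists_norm_lt y hδ
      rw [← mk_mul]
      exact (norm_mk_le _).trans ((norm_mul_le a b).trans
        (mul_le_mul ha.le hb.le (norm_nonneg _) ((norm_nonneg _).trans ha.le)))
    linarith

instance instStarRing : StarRing (SeqQuotient M) where
  star_involutive x := by
    obtain ⟨a, rfl⟩ := mk_surjective x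
    rw [← mk_star, ← mk_star, star_star]
  star_mul x y := by
    obtain ⟨a, rfl⟩ := mk_surjective x
    obtain ⟨b, rfl⟩ := mk_surjective y
    simp only [← mk_star, ← mk_mul, star_mul]
  star_add x y := by
    obtain ⟨a, rfl⟩ := mk_surjective x
    obtain ⟨b, rfl⟩ := mk_surjective y
    simp only [← mk_star, ← map_add, star_add]

lemma norm_mul_self_le (x : SeqQuotient M) : ‖x‖ * ‖x‖ ≤ ‖star x * x‖ := by
  classical
  obtain ⟨a, rfl⟩ := mk_surjective x
  refine le_of_forall_pos_le_add fun ε hε => ?_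
  rw [← mk_star, ← mk_mul]
  obtain ⟨m, hm, hmn⟩ := exists_norm_lt (mk M (star a * a)) (half_pos hε)
  obtain ⟨n, hn⟩ := mem_nullSeq.1 (mk_eq_mk.1 hm.symm) (ε / 2) (half_pos hε)
  set C : ℝ := ‖mk M (star a * a)‖ + ε
  have hC : 0 ≤ C := by positivity
  have hbd : ∀ i ≥ n, ‖a i‖ ≤ Real.sqrt C := by
    intro i hi
    refine Real.le_sqrt_of_sq_le ?_
    have h1 : ‖star (a i) * a i‖ = ‖a i‖ * ‖a i‖ := CStarRing.norm_star_mul_self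
    have h2 : ‖star (a i) * a i - m i‖ < ε / 2 := hn i hi
    have h3 : ‖m i‖ ≤ ‖m‖ := lp.norm_apply_le_norm ENNReal.top_ne_zero m i
    have h4 := norm_sub_norm_le (star (a i) * a i) (m i)
    rw [pow_two, ← h1]
    simp only [C]
    linarith
  let t : lp M ∞ := ⟨fun i => if n ≤ i then a i else 0, memℓp_infty ⟨Real.sqrt C, by
    rintro _ ⟨i, rfl⟩
    by_cases h : n ≤ i
    · simpa [h] using hbd i h
    · simp [h]⟩⟩
  have ht : ‖t‖ ≤ Real.sqrt C := by
    refine lp.norm_le_of_forall_le (Real.sqrt_nonneg _) fun i => ?_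
    change ‖if n ≤ i then a i else 0‖ ≤ _
    by_cases h : n ≤ i
    · simpa [h] using hbd i h
    · simp [h]
  have hat : mk M a = mk M t := by
    rw [mk_eq_mk, mem_nullSeq]
    intro δ hδ
    refine ⟨n, fun i hi => ?_⟩
    change ‖a i - (if n ≤ i then a i else 0)‖ < δ
    rw [if_pos hi, sub_self, norm_zero]
    exact hδ
  have h5 : ‖mk M a‖ ≤ Real.sqrt C := hat ▸ (norm_mk_le t).trans ht
  calc ‖mk M a‖ * ‖mk M a‖ ≤ Real.sqrt C * Real.sqrt C :=
        mul_le_mul h5 h5 (norm_nonneg _) (Real.sqrt_nonneg _)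
    _ = C := Real.mul_self_sqrt hC

instance instNonUnitalCStarAlgebra : NonUnitalCStarAlgebra (SeqQuotient M) where
  __ := instNonUnitalNormedRing
  __ := instStarRing
  __ := instNormedSpace M
  __ := instCompleteSpace M
  norm_mul_self_le := norm_mul_self_le
  smul_assoc c x y := by
    obtain ⟨a, rfl⟩ := mk_surjective x
    obtain ⟨b, rfl⟩ := mk_surjective y
    simp only [smul_eq_mul, ← map_smul, ← mk_mul, smul_mul_assoc]
  smul_comm c x y := by
    obtain ⟨a, rfl⟩ := mk_surjective x
    obtain ⟨b, rfl⟩ := mk_surjective y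
    simp only [smul_eq_mul, ← map_smul, ← mk_mul, mul_smul_comm]
  star_smul c x := by
    obtain ⟨a, rfl⟩ := mk_surjective x
    simp only [← map_smul, ← mk_star, star_smul]

end SeqQuotient

end SeqQuotient

/-- The (separable) C⋆-algebra `B` is MF: there is a sequence `(k_i)` of natural numbers such that
`B` embeds, as a C⋆-algebra, into `∏ M_{k_i}(ℂ) / ⨁ M_{k_i}(ℂ)`. -/
def IsMF (B : Type u) [NonUnitalCStarAlgebra B] : Prop :=
  ∃ (k : ℕ → ℕ) (j : B →⋆ₙₐ[ℂ] SeqQuotient fun i => CStarMatrix (Fin (k i)) (Fin (k i)) ℂ),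
    Function.Injective j

end

/-! Every `b ∈ B` is represented, via the MF embedding `j`, by a bounded sequence of matrices. The
pairs `(b, x)` with `x` representing `j b` form a C⋆-algebra `D ⊆ B × ∏ M_{k_i}(ℂ)`, an extension of
`B` by the ideal `J` of null sequences, with evaluations `ev i : D → M_{k_i}(ℂ)`. The sequences of
images of an element `y` of `A ⊗ D` in the algebras `A ⊗ M_{k_i}(ℂ)` tend to zero exactly when `y`
vanishes in `A ⊗ B`:

* If `y` vanishes in `A ⊗ B`, then it lies in `A ⊗ J` by exactness of `A`, and the claim is clear on
  elementary tensors (`SpatialTensor.tendsto_norm_map_id`).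
* Conversely, if the images tend to zero, all slices `(ω ⊗ id)(y) ∈ D` lie in `J`, where `ω` is a
  coefficient functional of a representation of `A`. As slices are compatible with all
  representations of `D`, in particular with those that factor through `B`, this kills `y` in
  `A ⊗ B` (`SpatialTensor.map_id_eq_zero_of_tendsto`). That the slices exist as elements of `D`
  rests on the Gelfand–Naimark theorem (`exists_rep_norm_apply_eq`).

Stable finiteness is expressed without units: in all matrix algebras, `x + x⋆ + x⋆x = 0` implies
`x + x⋆ + xx⋆ = 0` (`IsQuasiFinite`). It passes from `A` to `A ⊗ M_k(ℂ)`, which embeds into `M_k(A)`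
(`SpatialTensor.exists_matrix_embedding`). Given such an `x` over `A ⊗ B`, lift it to `A ⊗ D`. The
images over `A ⊗ M_{k_i}(ℂ)` are approximate isometries `1 + x_i`, hence by polar decomposition
approximate coisometries (`IsQuasiFinite.norm_add_star_add_mul_star_le`), so `x + x⋆ + xx⋆`
vanishes over `A ⊗ B`. -/

noncomputable section

/-! ### Quasi-finite rings and stable finiteness -/

/-- A not necessarily unital ⋆-ring `R` is quasi-finite if `x + x⋆ + x⋆x = 0` implies
`x + x⋆ + xx⋆ = 0`. Formally adjoining a unit, this says that every isometry of the form `1 + x`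
is unitary; the condition itself does not mention a unit, so it treats the two cases in the
definition of stable finiteness uniformly. -/
def IsQuasiFinite (R : Type*) [NonUnitalRing R] [StarRing R] : Prop :=
  ∀ x : R, x + star x + star x * x = 0 → x + star x + x * star x = 0

lemma IsQuasiFinite.of_injective {R S : Type*} [NonUnitalRing R] [StarRing R] [NonUnitalRing S]
    [StarRing S] (hS : IsQuasiFinite S) (f : R →⋆ₙ+* S) (hf : Function.Injective f) :
    IsQuasiFinite R := by
  intro x hx
  apply hf
  have h := hS (f x) (by rw [← map_star, ← map_mul, ← map_add, ← map_add, hx, map_zero])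
  rwa [← map_star, ← map_mul, ← map_add, ← map_add, ← map_zero f] at h

/-- Entrywise application of a ⋆-homomorphism to square matrices. -/
def Matrix.mapNonUnitalStarRingHom {R S : Type*} [NonUnitalRing R] [StarRing R] [NonUnitalRing S]
    [StarRing S] (ι : Type*) [Fintype ι] (f : R →⋆ₙ+* S) : Matrix ι ι R →⋆ₙ+* Matrix ι ι S where
  toFun x := x.map f
  map_zero' := by ext; simp
  map_add' _ _ := by ext; simp
  map_mul' _ _ := by ext; simp [Matrix.mul_apply]
  map_star' _ := by ext; simp [Matrix.star_apply, map_star]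

lemma Matrix.mapNonUnitalStarRingHom_injective {R S : Type*} [NonUnitalRing R] [StarRing R]
    [NonUnitalRing S] [StarRing S] (ι : Type*) [Fintype ι] {f : R →⋆ₙ+* S}
    (hf : Function.Injective f) : Function.Injective (Matrix.mapNonUnitalStarRingHom ι f) := by
  intro x y h
  ext i j
  exact hf (congrFun (congrFun h i) j)

/-- Quasi-finiteness of matrix rings passes to arbitrary finite index types. -/
lemma isQuasiFinite_matrix_of_fin {R ι : Type*} [NonUnitalRing R] [StarRing R] [Fintype ι]
    (h : ∀ n : ℕ, IsQuasiFinite (Matrix (Fin n) (Fin n) R)) : IsQuasiFinite (Matrix ι ι R) := by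
  let e := (Fintype.equivFin ι).symm
  refine (h (Fintype.card ι)).of_injective
    { toFun := fun x => x.submatrix e e
      map_zero' := rfl
      map_add' := fun _ _ => rfl
      map_mul' := fun x y => (Matrix.submatrix_mul_equiv x y e e e).symm
      map_star' := fun _ => rfl } ?_
  intro x y hxy
  ext i j
  have h' : x (e (e.symm i)) (e (e.symm j)) = y (e (e.symm i)) (e (e.symm j)) :=
    congrFun (congrFun hxy (e.symm i)) (e.symm j)
  simpa using h'

/-- Matrices of matrices are matrices over the product index type. -/
lemma isQuasiFinite_matrix_matrix {R ι κ : Type*} [NonUnitalRing R] [StarRing R] [Fintype ι]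
    [Fintype κ] (h : IsQuasiFinite (Matrix (ι × κ) (ι × κ) R)) :
    IsQuasiFinite (Matrix ι ι (Matrix κ κ R)) := by
  refine h.of_injective
    { toFun := fun x => Matrix.comp ι ι κ κ R x
      map_zero' := rfl
      map_add' := fun _ _ => rfl
      map_mul' := fun x y => by
        ext ⟨i, p⟩ ⟨j, q⟩
        simp [Matrix.mul_apply, Fintype.sum_prod_type, Matrix.sum_apply]
      map_star' := fun _ => rfl } ?_
  exact (Matrix.comp ι ι κ κ R).injective

section StablyFinite

variable {A : Type u} [NonUnitalCStarAlgebra A]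

/-- The inclusion of `A` into its unitization as a homomorphism of ⋆-rings. -/
def inrStarRingHom (A : Type u) [NonUnitalCStarAlgebra A] : A →⋆ₙ+* Unitization ℂ A where
  toFun a := (a : Unitization ℂ A)
  map_zero' := Unitization.inr_zero ℂ
  map_add' := Unitization.inr_add ℂ
  map_mul' := Unitization.inr_mul ℂ
  map_star' a := Unitization.inr_star a

lemma inrStarRingHom_injective : Function.Injective (inrStarRingHom A) :=
  Unitization.inr_injective

lemma star_one_add_mul {R : Type*} [Ring R] [StarRing R] (x : R) :
    star (1 + x) * (1 + x) = 1 + (x + star x + star x * x) := by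
  rw [star_add, star_one]; noncomm_ring

lemma one_add_mul_star {R : Type*} [Ring R] [StarRing R] (x : R) :
    (1 + x) * star (1 + x) = 1 + (x + star x + x * star x) := by
  rw [star_add, star_one]; noncomm_ring

lemma diagonal_mul_of_isCStarUnit {e : A} (he : IsCStarUnit e) {n : ℕ}
    (x : Matrix (Fin n) (Fin n) A) : Matrix.diagonal (fun _ => e) * x = x := by
  ext i j; simp [Matrix.diagonal_mul, (he _).1]

lemma mul_diagonal_of_isCStarUnit {e : A} (he : IsCStarUnit e) {n : ℕ}
    (x : Matrix (Fin n) (Fin n) A) : x * Matrix.diagonal (fun _ => e) = x := by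
  ext i j; simp [Matrix.mul_diagonal, (he _).2]

lemma IsCStarUnit.star_eq {e : A} (he : IsCStarUnit e) : star e = e := by
  have h1 : star e * e = star e := (he _).2
  have h2 : star e * e = e := by simpa using congrArg star (he (star e)).2
  exact h1.symm.trans h2

lemma star_diagonal_of_isCStarUnit {e : A} (he : IsCStarUnit e) (n : ℕ) :
    star (Matrix.diagonal fun _ : Fin n => e) = Matrix.diagonal fun _ => e := by
  rw [Matrix.star_eq_conjTranspose, Matrix.diagonal_conjTranspose]
  congr 1; ext; exact he.star_eq

lemma star_diagonal_add_mul {e : A} (he : IsCStarUnit e) {n : ℕ} (x : Matrix (Fin n) (Fin n) A) :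
    star (Matrix.diagonal (fun _ => e) + x) * (Matrix.diagonal (fun _ => e) + x) =
      Matrix.diagonal (fun _ => e) + (x + star x + star x * x) := by
  rw [star_add, star_diagonal_of_isCStarUnit he, add_mul, mul_add, mul_add,
    mul_diagonal_of_isCStarUnit he, mul_diagonal_of_isCStarUnit he, diagonal_mul_of_isCStarUnit he]
  abel

lemma diagonal_add_mul_star {e : A} (he : IsCStarUnit e) {n : ℕ} (x : Matrix (Fin n) (Fin n) A) :
    (Matrix.diagonal (fun _ => e) + x) * star (Matrix.diagonal (fun _ => e) + x) =
      Matrix.diagonal (fun _ => e) + (x + star x + x * star x) := by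
  rw [star_add, star_diagonal_of_isCStarUnit he, add_mul, mul_add, mul_add,
    mul_diagonal_of_isCStarUnit he, mul_diagonal_of_isCStarUnit he, diagonal_mul_of_isCStarUnit he]
  abel

lemma IsStablyFinite.isQuasiFinite_matrix (hA : IsStablyFinite A) (n : ℕ) :
    IsQuasiFinite (Matrix (Fin n) (Fin n) A) := by
  by_cases h : ∃ e : A, IsCStarUnit e
  · obtain ⟨e, he⟩ := h
    intro x hx
    have h := hA.1 e he n (Matrix.diagonal (fun _ => e) + x) (by
      rw [← Matrix.star_eq_conjTranspose, star_diagonal_add_mul he, hx, add_zero])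
    rw [← Matrix.star_eq_conjTranspose, diagonal_add_mul_star he] at h
    exact left_eq_add.1 h.symm
  · have hU : IsQuasiFinite (Matrix (Fin n) (Fin n) (Unitization ℂ A)) := by
      intro x hx
      have := hA.2 h n (1 + x) (by
        rw [← Matrix.star_eq_conjTranspose, star_one_add_mul, hx, add_zero])
      rw [← Matrix.star_eq_conjTranspose, one_add_mul_star] at this
      exact left_eq_add.1 this.symm
    exact hU.of_injective _ (Matrix.mapNonUnitalStarRingHom_injective _ inrStarRingHom_injective)

/-- The scalar part of an isometry in `M_n(A ⊕ ℂ)` is a unitary matrix; dividing by it leaves an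
isometry of the form `1 + x` with `x ∈ M_n(A)`. -/
lemma isStablyFinite_of_isQuasiFinite
    (h : ∀ n : ℕ, IsQuasiFinite (Matrix (Fin n) (Fin n) A)) : IsStablyFinite A := by
  refine ⟨fun e he n v hv => ?_, fun _ n v hv => ?_⟩
  · obtain ⟨x, rfl⟩ : ∃ x, v = Matrix.diagonal (fun _ => e) + x := ⟨_, (add_sub_cancel _ v).symm⟩
    rw [← Matrix.star_eq_conjTranspose] at hv ⊢
    rw [star_diagonal_add_mul he] at hv
    rw [diagonal_add_mul_star he, h n x (left_eq_add.1 hv.symm), add_zero]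
  · rw [← Matrix.star_eq_conjTranspose] at hv ⊢
    let F : Matrix (Fin n) (Fin n) (Unitization ℂ A) →+* Matrix (Fin n) (Fin n) ℂ :=
      (Unitization.fstHom ℂ A).toRingHom.mapMatrix
    let G : Matrix (Fin n) (Fin n) ℂ →+* Matrix (Fin n) (Fin n) (Unitization ℂ A) :=
      (algebraMap ℂ (Unitization ℂ A)).mapMatrix
    have hFstar (y) : F (star y) = star (F y) := by
      ext i j; simp [F, Matrix.star_apply]
    have hGstar (y) : G (star y) = star (G y) := by
      ext i j
      all_goals simp [G, Matrix.star_apply, Unitization.algebraMap_eq_inl]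
    have hFG (y) : F (G y) = y := by
      ext i j; simp [F, G, Unitization.algebraMap_eq_inl]
    have hu : star (F v) * F v = 1 := by rw [← hFstar, ← map_mul, hv, map_one]
    have hu' : F v * star (F v) = 1 := mul_eq_one_comm.1 hu
    obtain ⟨y, hy⟩ : ∃ y : Matrix (Fin n) (Fin n) A,
        G (star (F v)) * v = 1 + Matrix.mapNonUnitalStarRingHom _ (inrStarRingHom A) y := by
      refine ⟨(G (star (F v)) * v - 1).map fun z => z.snd, ?_⟩
      rw [← sub_eq_iff_eq_add']
      have h0 : F (G (star (F v)) * v - 1) = 0 := by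
        rw [map_sub, map_mul, hFG, hu, map_one, sub_self]
      ext i j
      · exact congrFun (congrFun h0 i) j
      · rfl
    have h1 : star (G (star (F v)) * v) * (G (star (F v)) * v) = 1 := by
      rw [star_mul, ← hGstar, star_star, mul_assoc, ← mul_assoc (G _) (G _), ← map_mul, hu',
        map_one, one_mul, hv]
    have h2 : (G (star (F v)) * v) * star (G (star (F v)) * v) = 1 := by
      rw [hy, star_one_add_mul] at h1
      have h3 := left_eq_add.1 h1.symm
      rw [← map_star, ← map_mul, ← map_add, ← map_add] at h3
      have h4 := h n y (Matrix.mapNonUnitalStarRingHom_injective _ inrStarRingHom_injective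
        (h3.trans (map_zero _).symm))
      rw [hy, one_add_mul_star, ← map_star, ← map_mul, ← map_add, ← map_add, h4, map_zero, add_zero]
    rw [star_mul, ← hGstar, star_star] at h2
    calc v * star v = G (F v) * (G (star (F v)) * v * (star v * G (F v))) * G (star (F v)) := by
          have h5 : G (F v) * G (star (F v)) = 1 := by rw [← map_mul, hu', map_one]
          simp only [← mul_assoc]
          rw [h5, one_mul, mul_assoc, h5, mul_one]
      _ = 1 := by rw [h2, mul_one, ← map_mul, hu', map_one]

end StablyFinite

/-! ### Approximate isometries -/

/-- An approximate isometry `1 + x` over a quasi-finite C⋆-algebra is an equally good approximate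
coisometry: in its polar decomposition `1 + x = w |1 + x|` the factor `w` is an isometry of
the form `1 + y`, hence unitary, and it conjugates `|1 + x|²` to `(1 + x) (1 + x)⋆`. -/
lemma IsQuasiFinite.norm_add_star_add_mul_star_le {C : Type*} [NonUnitalCStarAlgebra C]
    (hC : IsQuasiFinite C) {x : C} (hx : ‖x + star x + star x * x‖ ≤ 1 / 2) :
    ‖x + star x + x * star x‖ ≤ ‖x + star x + star x * x‖ := by
  let _ : PartialOrder (Unitization ℂ C) := CStarAlgebra.spectralOrder _
  let _ : StarOrderedRing (Unitization ℂ C) := CStarAlgebra.spectralOrderedRing _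
  set v : Unitization ℂ C := 1 + (x : Unitization ℂ C) with hv
  set z : C := x + star x + star x * x with hz
  have hvv : star v * v = 1 + (z : Unitization ℂ C) := by
    rw [hv, star_one_add_mul, hz]
    simp only [Unitization.inr_add, Unitization.inr_star, Unitization.inr_mul]
  have hvv' : v * star v = 1 + ((x + star x + x * star x : C) : Unitization ℂ C) := by
    rw [hv, one_add_mul_star]
    simp only [Unitization.inr_add, Unitization.inr_star, Unitization.inr_mul]
  set h : Unitization ℂ C := star v * v with hh
  have hunit : IsUnit h := by
    rw [hvv, show (1 : Unitization ℂ C) + (z : Unitization ℂ C) = 1 - -(z : Unitization ℂ C) by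
      rw [sub_neg_eq_add]]
    refine (Units.oneSub _ ?_).isUnit
    rw [norm_neg, Unitization.norm_inr]
    linarith
  have hpos : IsStrictlyPositive h := hunit.isStrictlyPositive (star_mul_self_nonneg v)
  set s : Unitization ℂ C := h ^ (-(1 / 2) : ℝ)
  set t : Unitization ℂ C := h ^ ((1 / 2) : ℝ) with ht
  have hs0 : 0 ≤ s := CFC.rpow_nonneg
  have ht0 : 0 ≤ t := CFC.rpow_nonneg
  have hshs : s * h * s = 1 := CFC.conjugate_rpow_neg_one_half h
  have hst : s * t = 1 := CFC.rpow_neg_mul_rpow _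
  have htt : t * t = h := by
    rw [ht, ← CFC.rpow_add hunit]
    norm_num
    exact CFC.rpow_one h
  have hs_star : star s = s := hs0.isSelfAdjoint
  have ht_star : star t = t := ht0.isSelfAdjoint
  -- `h` has scalar part `1` and `s ≥ 0`, so the scalar part of `s` is `1` as well
  have hfst : s.fst = 1 := by
    have h1 : s.fst * s.fst = 1 := by
      have := congrArg (fun y : Unitization ℂ C => y.fst) hshs
      simpa [hvv] using this
    obtain ⟨r, hr⟩ := CStarAlgebra.nonneg_iff_eq_star_mul_self.1 hs0
    have h2 : s.fst = star r.fst * r.fst := by rw [hr]; simp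
    rcases mul_self_eq_one_iff.1 h1 with h3 | h3
    · exact h3
    · have h4 : (0 : ℂ) ≤ s.fst := h2 ▸ star_mul_self_nonneg _
      rw [h3] at h4
      norm_num [Complex.le_def] at h4
  obtain ⟨y, hy⟩ : ∃ y : C, v * s = 1 + (y : Unitization ℂ C) := by
    refine ⟨(v * s - 1).snd, ?_⟩
    rw [← sub_eq_iff_eq_add']
    ext
    · change v.fst * s.fst - 1 = 0
      simp [hv, hfst]
    · rfl
  have hiso : star (v * s) * (v * s) = 1 := by
    rw [star_mul, hs_star, mul_assoc, ← mul_assoc (star v), ← mul_assoc, ← hh, hshs]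
  have hcoiso : (v * s) * star (v * s) = 1 := by
    rw [hy, star_one_add_mul, ← Unitization.inr_star, ← Unitization.inr_mul, ← Unitization.inr_add,
      ← Unitization.inr_add] at hiso
    have h0 : y + star y + star y * y = 0 :=
      Unitization.inr_injective (R := ℂ)
        ((left_eq_add.1 hiso.symm).trans (Unitization.inr_zero ℂ).symm)
    rw [hy, one_add_mul_star, ← Unitization.inr_star, ← Unitization.inr_mul, ← Unitization.inr_add,
      ← Unitization.inr_add, hC y h0, Unitization.inr_zero, add_zero]
  have hnorm : ‖v * s‖ ≤ 1 := by
    have := CStarRing.norm_star_mul_self (x := v * s)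
    rw [hiso, CStarRing.norm_one] at this
    nlinarith [norm_nonneg (v * s)]
  have hvw : v = (v * s) * t := by rw [mul_assoc, hst, mul_one]
  have hconj : v * star v - 1 = (v * s) * (h - 1) * star (v * s) := by
    rw [mul_sub, sub_mul, mul_one, hcoiso]
    congr 1
    conv_lhs => rw [hvw]
    rw [star_mul, ht_star, ← htt]
    simp only [mul_assoc]
  have hl : ‖x + star x + x * star x‖ = ‖v * star v - 1‖ := by
    rw [hvv', add_sub_cancel_left, Unitization.norm_inr]
  have hr : ‖z‖ = ‖h - 1‖ := by rw [hvv, add_sub_cancel_left, Unitization.norm_inr]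
  rw [hl, hr, hconj]
  calc ‖(v * s) * (h - 1) * star (v * s)‖ ≤ ‖v * s‖ * ‖h - 1‖ * ‖star (v * s)‖ :=
        (norm_mul_le _ _).trans (by gcongr; exact norm_mul_le _ _)
    _ ≤ 1 * ‖h - 1‖ * 1 := by
        rw [norm_star]; gcongr
    _ = ‖h - 1‖ := by ring

/-! ### Representations determine the norm -/

/-- A state on a unital C⋆-algebra that attains the norm at a given positive element `b`: the
hermitian part of a norming functional of `1 + b`. -/
lemma exists_state_apply_eq_norm {U : Type*} [CStarAlgebra U] [Nontrivial U] [PartialOrder U]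
    [StarOrderedRing U] {b : U} (hb : 0 ≤ b) : ∃ g : U →ₚ[ℂ] ℂ, g 1 = 1 ∧ g b = ‖b‖ := by
  obtain ⟨f, hf, hfb⟩ := exists_dual_vector'' ℂ (1 + b)
  have hnorm : ‖1 + b‖ = 1 + ‖b‖ := by
    refine le_antisymm ((norm_add_le _ _).trans (by rw [CStarRing.norm_one])) ?_
    have h1 : ‖b‖ ∈ spectrum ℝ b := CStarAlgebra.norm_mem_spectrum_of_nonneg hb
    have h2 : 1 + ‖b‖ ∈ spectrum ℝ (1 + b) := by
      have := spectrum.add_mem_add_iff (r := ‖b‖) (s := 1) (a := b)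
      rw [map_one] at this
      rw [add_comm 1 ‖b‖]
      exact this.2 h1
    have h3 := spectrum.norm_le_norm_of_mem h2
    rwa [Real.norm_of_nonneg (by positivity)] at h3
  have hre (y : U) : (f y).re ≤ ‖y‖ :=
    (Complex.re_le_norm _).trans ((f.le_of_opNorm_le hf y).trans (one_mul _).le)
  have h1 := hre 1
  have hb' := hre b
  rw [CStarRing.norm_one] at h1
  have hsum : (f 1).re + (f b).re = 1 + ‖b‖ := by
    have := congrArg Complex.re hfb
    rw [map_add, hnorm] at this
    simpa using this
  -- both summands are at most the corresponding norms, so equality in the sum forces both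
  have hf1 : (f 1).re = 1 := by linarith
  have hfb' : (f b).re = ‖b‖ := by linarith
  let g : U →ₗ[ℂ] ℂ :=
    { toFun := fun y => (f y + star (f (star y))) / 2
      map_add' := fun y z => by simp only [star_add, map_add]; ring
      map_smul' := fun c y => by
        simp only [star_smul, map_smul, smul_eq_mul, star_mul', star_star, RingHom.id_apply]; ring }
  have hg (y : U) (hy : IsSelfAdjoint y) : g y = ((f y).re : ℂ) := by
    change (f y + star (f (star y))) / 2 = _
    rw [hy.star_eq]
    apply Complex.ext <;> simp
  have hpos (y : U) (hy : 0 ≤ y) : 0 ≤ g y := by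
    rw [hg y hy.isSelfAdjoint]
    have h2 : ‖algebraMap ℝ U ‖y‖ - y‖ ≤ ‖y‖ := by
      have h3 : algebraMap ℝ U ‖y‖ - y ≤ algebraMap ℝ U ‖y‖ := sub_le_self _ hy
      have h4 : 0 ≤ algebraMap ℝ U ‖y‖ - y :=
        sub_nonneg.2 (IsSelfAdjoint.le_algebraMap_norm_self hy.isSelfAdjoint)
      refine (CStarAlgebra.norm_le_norm_of_nonneg_of_le h4 h3).trans ?_
      rw [norm_algebraMap', norm_norm]
    have h5 : f (algebraMap ℝ U ‖y‖) = (‖y‖ : ℂ) * f 1 := by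
      rw [Algebra.algebraMap_eq_smul_one, ← Complex.coe_smul, map_smul, smul_eq_mul]
    have h6 := (hre _).trans h2
    rw [map_sub, h5] at h6
    simp [hf1] at h6
    exact_mod_cast h6
  refine ⟨PositiveLinearMap.mk₀ g hpos, ?_, ?_⟩
  · change g 1 = 1
    rw [hg 1 (IsSelfAdjoint.one U), hf1, Complex.ofReal_one]
  · change g b = ‖b‖
    rw [hg b hb.isSelfAdjoint, hfb']

/-- Gelfand–Naimark: the representations of a C⋆-algebra determine its norm. -/
lemma exists_rep_norm_apply_eq {A : Type u} [NonUnitalCStarAlgebra A] (a : A) :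
    ∃ π : CStarRep A, ‖π.hom a‖ = ‖a‖ := by
  let _ : PartialOrder (Unitization ℂ A) := CStarAlgebra.spectralOrder _
  let _ : StarOrderedRing (Unitization ℂ A) := CStarAlgebra.spectralOrderedRing _
  obtain ⟨g, hg1, hgb⟩ := exists_state_apply_eq_norm
    (star_mul_self_nonneg (a : Unitization ℂ A))
  let π : CStarRep A :=
    { H := g.GNS
      hom := g.gnsNonUnitalStarAlgHom.comp (Unitization.inrNonUnitalStarAlgHom ℂ A) }
  refine ⟨π, le_antisymm (NonUnitalStarAlgHom.norm_apply_le π.hom a) ?_⟩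
  have hnorm (y : Unitization ℂ A) : ‖((g.toPreGNS y : g.PreGNS) : g.GNS)‖ ^ 2 =
      (g (star y * y)).re := by
    rw [UniformSpace.Completion.norm_coe]
    have := congrArg Complex.re (g.preGNS_norm_sq (g.toPreGNS y))
    rw [← Complex.ofReal_pow, Complex.ofReal_re] at this
    simpa using this
  have h1 : ‖((g.toPreGNS 1 : g.PreGNS) : g.GNS)‖ = 1 := by
    have := hnorm 1
    rw [star_one, one_mul, hg1, Complex.one_re] at this
    exact (pow_eq_one_iff_of_nonneg (norm_nonneg _) two_ne_zero).1 this
  have h2 : π.hom a ((g.toPreGNS 1 : g.PreGNS) : g.GNS) =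
      ((g.toPreGNS (a : Unitization ℂ A) : g.PreGNS) : g.GNS) := by
    change g.gnsNonUnitalStarAlgHom (a : Unitization ℂ A) _ = _
    rw [g.gnsNonUnitalStarAlgHom_apply_coe]
    simp
  have h3 : ‖((g.toPreGNS (a : Unitization ℂ A) : g.PreGNS) : g.GNS)‖ = ‖a‖ := by
    have := hnorm a
    rw [hgb, Complex.ofReal_re, CStarRing.norm_star_mul_self, Unitization.norm_inr, ← sq] at this
    exact (pow_left_inj₀ (norm_nonneg _) (norm_nonneg _) two_ne_zero).1 this
  have h4 := (π.hom a).le_opNorm ((g.toPreGNS 1 : g.PreGNS) : g.GNS)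
  rw [h2, h3] at h4
  exact h4.trans (by rw [show ‖((g.toPreGNS 1 : g.PreGNS) : π.H)‖ = 1 from h1, mul_one])

/-! ### Elementary tensors -/

section HilbertTensorVectors

variable {H : Type u} {K : Type v} [NormedAddCommGroup H] [InnerProductSpace ℂ H]
  [NormedAddCommGroup K] [InnerProductSpace ℂ K]

/-- The elementary tensor `ξ ⊗ η` in the Hilbert space tensor product. -/
def HilbertTensor.tmul (ξ : H) (η : K) : HilbertTensor H K :=
  ((ξ ⊗ₜ[ℂ] η : H ⊗[ℂ] K) : UniformSpace.Completion (H ⊗[ℂ] K))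

lemma HilbertTensor.inner_tmul (ξ ξ' : H) (η η' : K) :
    inner ℂ (HilbertTensor.tmul ξ η) (HilbertTensor.tmul ξ' η') = inner ℂ ξ ξ' * inner ℂ η η' :=
  (UniformSpace.Completion.inner_coe _ _).trans (TensorProduct.inner_tmul ..)

lemma HilbertTensor.norm_tmul (ξ : H) (η : K) : ‖HilbertTensor.tmul ξ η‖ = ‖ξ‖ * ‖η‖ :=
  (UniformSpace.Completion.norm_coe _).trans (TensorProduct.norm_tmul _ _)

lemma opTensor_coe (S : H →L[ℂ] H) (T : K →L[ℂ] K) (x : H ⊗[ℂ] K) :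
    opTensor S T (x : UniformSpace.Completion (H ⊗[ℂ] K)) =
      ((TensorProduct.mapL S T x : H ⊗[ℂ] K) : UniformSpace.Completion (H ⊗[ℂ] K)) :=
  ContinuousLinearMap.completion_apply_coe _ x

lemma opTensor_tmul (S : H →L[ℂ] H) (T : K →L[ℂ] K) (ξ : H) (η : K) :
    opTensor S T (HilbertTensor.tmul ξ η) = HilbertTensor.tmul (S ξ) (T η) := by
  rw [HilbertTensor.tmul, opTensor_coe, TensorProduct.mapL_tmul]; rfl

/-- Continuous linear maps on `H ⊗ K` that agree on elementary tensors are equal. -/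
lemma HilbertTensor.ext_tmul {E : Type*} [NormedAddCommGroup E] [NormedSpace ℂ E]
    {T T' : HilbertTensor H K →L[ℂ] E}
    (h : ∀ ξ η, T (HilbertTensor.tmul ξ η) = T' (HilbertTensor.tmul ξ η)) : T = T' := by
  ext x
  induction x using UniformSpace.Completion.induction_on with
  | hp => exact isClosed_eq T.continuous T'.continuous
  | ih x =>
    induction x using TensorProduct.induction_on with
    | zero =>
      have h0 : ((0 : H ⊗[ℂ] K) : UniformSpace.Completion (H ⊗[ℂ] K)) =
        (0 : HilbertTensor H K) := UniformSpace.Completion.coe_zero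
      rw [h0, map_zero, map_zero]
    | tmul ξ η => exact h ξ η
    | add x y hx hy =>
      let x' : HilbertTensor H K := (x : UniformSpace.Completion (H ⊗[ℂ] K))
      let y' : HilbertTensor H K := (y : UniformSpace.Completion (H ⊗[ℂ] K))
      have h1 : ((x + y : H ⊗[ℂ] K) : UniformSpace.Completion (H ⊗[ℂ] K)) = x' + y' :=
        UniformSpace.Completion.coe_add x y
      have hx' : T x' = T' x' := hx
      have hy' : T y' = T' y' := hy
      rw [h1, map_add, map_add, hx', hy']

lemma HilbertTensor.ext_inner_tmul {T T' : HilbertTensor H K →L[ℂ] HilbertTensor H K}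
    (h : ∀ ξ η ξ' η', inner ℂ (HilbertTensor.tmul ξ η) (T (HilbertTensor.tmul ξ' η')) =
      inner ℂ (HilbertTensor.tmul ξ η) (T' (HilbertTensor.tmul ξ' η'))) : T = T' := by
  refine HilbertTensor.ext_tmul fun ξ' η' => ?_
  refine ext_inner_right ℂ fun z => ?_
  have h2 : innerSL ℂ (T (HilbertTensor.tmul ξ' η')) =
      innerSL ℂ (T' (HilbertTensor.tmul ξ' η')) := by
    refine HilbertTensor.ext_tmul fun ξ η => ?_
    rw [innerSL_apply_apply, innerSL_apply_apply, ← inner_conj_symm, h, inner_conj_symm]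
  exact congrArg (fun f => f z) h2

end HilbertTensorVectors

namespace SpatialTensor

variable {A : Type u} {B : Type v} [NonUnitalCStarAlgebra A] [NonUnitalCStarAlgebra B]

/-- The representation `π ⊗ σ` of `A ⊗ B`. -/
def rep (π : CStarRep A) (σ : CStarRep B) :
    SpatialTensor A B →⋆ₙₐ[ℂ] (HilbertTensor π.H σ.H →L[ℂ] HilbertTensor π.H σ.H) where
  toFun x := x.1.1 (π, σ)
  map_smul' _ _ := rfl
  map_zero' := rfl
  map_add' _ _ := rfl
  map_mul' _ _ := rfl
  map_star' _ := rfl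

lemma rep_tmul (π : CStarRep A) (σ : CStarRep B) (a : A) (b : B) :
    rep π σ (tmul a b) = opTensor (π.hom a) (σ.hom b) := rfl

lemma norm_rep_le (π : CStarRep A) (σ : CStarRep B) (x : SpatialTensor A B) :
    ‖rep π σ x‖ ≤ ‖x‖ :=
  NonUnitalStarAlgHom.norm_apply_le (rep π σ) x

lemma ext_rep {x y : SpatialTensor A B} (h : ∀ π σ, rep π σ x = rep π σ y) : x = y := by
  apply Subtype.ext
  apply lp.ext
  funext p
  exact h p.1 p.2

lemma norm_tmul_le (a : A) (b : B) : ‖(tmul a b : SpatialTensor A B)‖ ≤ ‖a‖ * ‖b‖ := by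
  refine lp.norm_le_of_forall_le (by positivity) fun p => ?_
  exact (norm_opTensor_le _ _).trans (mul_le_mul (NonUnitalStarAlgHom.norm_apply_le p.1.hom a)
    (NonUnitalStarAlgHom.norm_apply_le p.2.hom b) (norm_nonneg _) (norm_nonneg _))

lemma tmul_mul_tmul (a a' : A) (b b' : B) :
    (tmul a b * tmul a' b' : SpatialTensor A B) = tmul (a * a') (b * b') := by
  refine ext_rep fun π σ => HilbertTensor.ext_tmul fun ξ η => ?_
  rw [map_mul]
  simp only [rep_tmul, mul_apply_eq_comp, opTensor_tmul, map_mul]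

lemma star_tmul (a : A) (b : B) :
    star (tmul a b : SpatialTensor A B) = tmul (star a) (star b) := by
  refine ext_rep fun π σ => HilbertTensor.ext_inner_tmul fun ξ η ξ' η' => ?_
  rw [map_star, ContinuousLinearMap.star_eq_adjoint, ContinuousLinearMap.adjoint_inner_right]
  simp only [rep_tmul, opTensor_tmul, HilbertTensor.inner_tmul, map_star,
    ContinuousLinearMap.star_eq_adjoint, ContinuousLinearMap.adjoint_inner_right]

lemma add_tmul (a a' : A) (b : B) :
    (tmul (a + a') b : SpatialTensor A B) = tmul a b + tmul a' b := by
  refine ext_rep fun π σ => HilbertTensor.ext_inner_tmul fun ξ η ξ' η' => ?_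
  simp only [map_add, rep_tmul, opTensor_tmul, HilbertTensor.inner_tmul, inner_add_right,
    add_apply, add_mul]

lemma smul_tmul' (c : ℂ) (a : A) (b : B) :
    (tmul (c • a) b : SpatialTensor A B) = c • tmul a b := by
  refine ext_rep fun π σ => HilbertTensor.ext_inner_tmul fun ξ η ξ' η' => ?_
  simp only [map_smul, rep_tmul, opTensor_tmul, HilbertTensor.inner_tmul, inner_smul_right,
    smul_apply, mul_assoc]

lemma tmul_add (a : A) (b b' : B) :
    (tmul a (b + b') : SpatialTensor A B) = tmul a b + tmul a b' := by
  refine ext_rep fun π σ => HilbertTensor.ext_inner_tmul fun ξ η ξ' η' => ?_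
  simp only [map_add, rep_tmul, opTensor_tmul, HilbertTensor.inner_tmul, inner_add_right,
    add_apply, mul_add]

lemma tmul_smul (c : ℂ) (a : A) (b : B) :
    (tmul a (c • b) : SpatialTensor A B) = c • tmul a b := by
  refine ext_rep fun π σ => HilbertTensor.ext_inner_tmul fun ξ η ξ' η' => ?_
  simp only [map_smul, rep_tmul, opTensor_tmul, HilbertTensor.inner_tmul, inner_smul_right,
    smul_apply, mul_left_comm]

/-- `a ↦ a ⊗ b` as a continuous linear map. -/
def tmulRight (b : B) : A →L[ℂ] SpatialTensor A B :=
  LinearMap.mkContinuous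
    { toFun := fun a => tmul a b
      map_add' := fun a a' => add_tmul a a' b
      map_smul' := fun c a => smul_tmul' c a b } ‖b‖
    fun a => (norm_tmul_le a b).trans (mul_comm _ _).le

/-- The linear span of the elementary tensors is already a ⋆-subalgebra. -/
lemma mem_span_of_mem_adjoin {x : RepProd A B} (hx : x ∈ NonUnitalStarAlgebra.adjoin ℂ
    (Set.range fun p : A × B => repTensor p.1 p.2)) :
    x ∈ Submodule.span ℂ (Set.range fun p : A × B => repTensor p.1 p.2) := by
  induction hx using NonUnitalStarAlgebra.adjoin_induction with
  | mem x hx => exact Submodule.subset_span hx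
  | add x y _ _ hx hy => exact add_mem hx hy
  | zero => exact zero_mem _
  | smul c x _ hx => exact Submodule.smul_mem _ c hx
  | mul x y hx' hy' hx hy =>
    clear hx' hy'
    induction hx, hy using Submodule.span_induction₂ with
    | mem_mem x y hx hy =>
      obtain ⟨⟨a, b⟩, rfl⟩ := hx
      obtain ⟨⟨a', b'⟩, rfl⟩ := hy
      refine Submodule.subset_span ⟨(a * a', b * b'), ?_⟩
      exact (congrArg Subtype.val (tmul_mul_tmul a a' b b')).symm
    | zero_left => rw [zero_mul]; exact zero_mem _
    | zero_right => rw [mul_zero]; exact zero_mem _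
    | add_left x y z _ _ _ h1 h2 => rw [add_mul]; exact add_mem h1 h2
    | add_right x y z _ _ _ h1 h2 => rw [mul_add]; exact add_mem h1 h2
    | smul_left c x y _ _ h => rw [smul_mul_assoc]; exact Submodule.smul_mem _ c h
    | smul_right c x y _ _ h => rw [mul_smul_comm]; exact Submodule.smul_mem _ c h
  | star x hx' hx =>
    clear hx'
    induction hx using Submodule.span_induction with
    | mem x hx =>
      obtain ⟨⟨a, b⟩, rfl⟩ := hx
      refine Submodule.subset_span ⟨(star a, star b), ?_⟩
      exact (congrArg Subtype.val (star_tmul a b)).symm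
    | zero => rw [star_zero]; exact zero_mem _
    | add x y _ _ h1 h2 => rw [star_add]; exact add_mem h1 h2
    | smul c x _ h => rw [star_smul]; exact Submodule.smul_mem _ _ h

/-- The elementary tensors span a dense subspace. -/
lemma eq_top_of_tmul_mem (S : Submodule ℂ (SpatialTensor A B))
    (hS : IsClosed (S : Set (SpatialTensor A B))) (h : ∀ a b, tmul a b ∈ S) : S = ⊤ := by
  rw [eq_top_iff]
  rintro x -
  have hle : ∀ y ∈ Submodule.span ℂ (Set.range fun p : A × B => repTensor p.1 p.2),
      ∃ z ∈ S, (z : RepProd A B) = y := by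
    intro y hy
    induction hy using Submodule.span_induction with
    | mem y hy =>
      obtain ⟨⟨a, b⟩, rfl⟩ := hy
      exact ⟨tmul a b, h a b, rfl⟩
    | zero => exact ⟨0, zero_mem _, rfl⟩
    | add y y' _ _ h1 h2 =>
      obtain ⟨z, hz, rfl⟩ := h1
      obtain ⟨z', hz', rfl⟩ := h2
      exact ⟨z + z', add_mem hz hz', rfl⟩
    | smul c y _ h1 =>
      obtain ⟨z, hz, rfl⟩ := h1
      exact ⟨c • z, S.smul_mem c hz, rfl⟩
  have hx : (x : RepProd A B) ∈ closure ((NonUnitalStarAlgebra.adjoin ℂ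
    (Set.range fun p : A × B => repTensor p.1 p.2) : NonUnitalStarSubalgebra ℂ (RepProd A B)) :
      Set (RepProd A B)) := x.2
  refine hS.closure_subset (Metric.mem_closure_iff.2 fun ε hε => ?_)
  obtain ⟨y, hy, hxy⟩ := Metric.mem_closure_iff.1 hx ε hε
  obtain ⟨z, hz, rfl⟩ := hle y (mem_span_of_mem_adjoin hy)
  exact ⟨z, hz, hxy⟩

/-- Continuous linear maps on `A ⊗ B` that agree on elementary tensors are equal. -/
lemma ext_tmul {E : Type*} [NormedAddCommGroup E] [NormedSpace ℂ E]
    {T T' : SpatialTensor A B →L[ℂ] E} (h : ∀ a b, T (tmul a b) = T' (tmul a b)) : T = T' := by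
  have : (T - T').ker = ⊤ := eq_top_of_tmul_mem _ (T - T').isClosed_ker fun a b => by
    simp [h a b]
  ext x
  have hx : x ∈ (T - T').ker := this ▸ Submodule.mem_top
  simpa [sub_eq_zero] using hx

end SpatialTensor

/-! ### Slice maps -/

/-- A closed linear relation from `E` to `F`, described by equations `a i y = b i x`, is the graph
of a continuous linear map as soon as it bounds `‖y‖` by a multiple of `‖x‖` and its domain is
dense. -/
lemma exists_clm_of_forall_apply_eq {E F ι : Type*} [NormedAddCommGroup E] [NormedSpace ℂ E]
    [NormedAddCommGroup F] [NormedSpace ℂ F] [CompleteSpace E] [CompleteSpace F]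
    (a : ι → F →L[ℂ] ℂ) (b : ι → E →L[ℂ] ℂ) (C : ℝ)
    (hC : ∀ x y, (∀ i, a i y = b i x) → ‖y‖ ≤ C * ‖x‖) (D : Set E)
    (hD : ∀ S : Submodule ℂ E, IsClosed (S : Set E) → D ⊆ S → S = ⊤)
    (h : ∀ x ∈ D, ∃ y, ∀ i, a i y = b i x) :
    ∃ R : E →L[ℂ] F, ∀ x i, a i (R x) = b i x := by
  let G : Submodule ℂ (E × F) :=
    ⨅ i, ((a i).comp (ContinuousLinearMap.snd ℂ E F) -
      (b i).comp (ContinuousLinearMap.fst ℂ E F)).ker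
  have hGmem (p : E × F) : p ∈ G ↔ ∀ i, a i p.2 = b i p.1 := by
    simp [G, Submodule.mem_iInf, sub_eq_zero]
  have hGclosed : IsClosed (G : Set (E × F)) := by
    have : (G : Set (E × F)) = ⋂ i, {p | a i p.2 = b i p.1} := by
      ext p; simp [hGmem]
    rw [this]
    exact isClosed_iInter fun i => isClosed_eq (by fun_prop) (by fun_prop)
  have : CompleteSpace G := hGclosed.completeSpace_coe
  let f : G →L[ℂ] E := (ContinuousLinearMap.fst ℂ E F).comp G.subtypeL
  have hbound (p : G) : ‖p‖ ≤ (max 1 C).toNNReal * ‖f p‖ := by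
    rw [Real.coe_toNNReal _ (zero_le_one.trans (le_max_left _ _))]
    have h2 := hC p.1.1 p.1.2 ((hGmem p.1).1 p.2)
    have h3 : ‖f p‖ = ‖p.1.1‖ := rfl
    have h4 : ‖p‖ = max ‖p.1.1‖ ‖p.1.2‖ := rfl
    rw [h3, h4]
    refine max_le ?_ (h2.trans ?_)
    · exact le_mul_of_one_le_left (norm_nonneg _) (le_max_left _ _)
    · exact mul_le_mul_of_nonneg_right (le_max_right _ _) (norm_nonneg _)
  have hanti : AntilipschitzWith (max 1 C).toNNReal f :=
    ContinuousLinearMap.antilipschitz_of_bound f hbound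
  have hrange : f.range = ⊤ := by
    refine hD _ ?_ fun x hx => ?_
    · exact hanti.isClosed_range f.uniformContinuous
    · obtain ⟨y, hy⟩ := h x hx
      exact ⟨⟨(x, y), (hGmem _).2 hy⟩, rfl⟩
  let e : G ≃L[ℂ] E := ContinuousLinearEquiv.ofBijective f
    (LinearMap.ker_eq_bot.2 hanti.injective) hrange
  refine ⟨(ContinuousLinearMap.snd ℂ E F).comp (G.subtypeL.comp (e.symm : E →L[ℂ] G)),
    fun x i => ?_⟩
  have h5 := (hGmem _).1 (e.symm x).2 i
  have h6 : (e.symm x).1.1 = x := e.apply_symm_apply x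
  rw [h6] at h5
  exact h5

lemma norm_inner_apply_le {H : Type*} [NormedAddCommGroup H] [InnerProductSpace ℂ H]
    (T : H →L[ℂ] H) {C : ℝ} (hT : ‖T‖ ≤ C) (k k' : H) :
    ‖inner ℂ k (T k')‖ ≤ C * ‖k‖ * ‖k'‖ :=
  calc ‖inner ℂ k (T k')‖ ≤ ‖k‖ * ‖T k'‖ := norm_inner_le_norm _ _
    _ ≤ ‖k‖ * (C * ‖k'‖) := by gcongr; exact T.le_of_opNorm_le hT k'
    _ = C * ‖k‖ * ‖k'‖ := by ring

/-- The coefficient functional `a ↦ ⟪k, π(a) k'⟫` of a representation. -/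
def CStarRep.coeff {A : Type u} [NonUnitalCStarAlgebra A] (π : CStarRep A) (k k' : π.H) :
    A →L[ℂ] ℂ :=
  LinearMap.mkContinuous
    { toFun := fun a => inner ℂ k (π.hom a k')
      map_add' := fun a a' => by simp
      map_smul' := fun c a => by simp } (‖k‖ * ‖k'‖)
    fun a => (norm_inner_apply_le _ (NonUnitalStarAlgHom.norm_apply_le π.hom a) k k').trans_eq
      (by ring)

lemma CStarRep.coeff_apply {A : Type u} [NonUnitalCStarAlgebra A] (π : CStarRep A) (k k' : π.H)
    (a : A) : π.coeff k k' a = inner ℂ k (π.hom a k') := rfl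

/-- By Gelfand–Naimark, the coefficients of an element of a C⋆-algebra determine its norm. -/
lemma norm_le_of_forall_coeff_le {A : Type u} [NonUnitalCStarAlgebra A] {a : A} {C : ℝ}
    (hC : 0 ≤ C) (h : ∀ (π : CStarRep A) (k k' : π.H), ‖π.coeff k k' a‖ ≤ C * ‖k‖ * ‖k'‖) :
    ‖a‖ ≤ C := by
  obtain ⟨π, hπ⟩ := exists_rep_norm_apply_eq a
  rw [← hπ]
  refine ContinuousLinearMap.opNorm_le_bound _ hC fun k' => ?_
  have h1 := h π (π.hom a k') k'
  rw [CStarRep.coeff_apply, inner_self_eq_norm_sq_to_K, norm_pow] at h1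
  simp only [RCLike.norm_ofReal, abs_norm] at h1
  rcases (norm_nonneg (π.hom a k')).eq_or_lt with h0 | h0
  · rw [← h0]; positivity
  · nlinarith

lemma eq_of_forall_coeff_eq {A : Type u} [NonUnitalCStarAlgebra A] {a a' : A}
    (h : ∀ (π : CStarRep A) (k k' : π.H), π.coeff k k' a = π.coeff k k' a') : a = a' := by
  rw [← sub_eq_zero, ← norm_le_zero_iff]
  exact norm_le_of_forall_coeff_le le_rfl fun π k k' => by rw [map_sub, h]; simp

namespace SpatialTensor

variable {A : Type u} {B : Type v} [NonUnitalCStarAlgebra A] [NonUnitalCStarAlgebra B]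

/-- The coefficient functional `x ↦ ⟪ζ, (π ⊗ σ)(x) ζ'⟫`. -/
def coeff (π : CStarRep A) (σ : CStarRep B) (ζ ζ' : HilbertTensor π.H σ.H) :
    SpatialTensor A B →L[ℂ] ℂ :=
  LinearMap.mkContinuous
    { toFun := fun x => inner ℂ ζ (rep π σ x ζ')
      map_add' := fun x x' => by simp
      map_smul' := fun c x => by simp } (‖ζ‖ * ‖ζ'‖)
    fun x => (norm_inner_apply_le _ (norm_rep_le π σ x) ζ ζ').trans_eq (by ring)

lemma coeff_apply (π : CStarRep A) (σ : CStarRep B) (ζ ζ' : HilbertTensor π.H σ.H)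
    (x : SpatialTensor A B) : coeff π σ ζ ζ' x = inner ℂ ζ (rep π σ x ζ') := rfl

lemma norm_coeff_le (π : CStarRep A) (σ : CStarRep B) (ζ ζ' : HilbertTensor π.H σ.H)
    (x : SpatialTensor A B) : ‖coeff π σ ζ ζ' x‖ ≤ ‖x‖ * ‖ζ‖ * ‖ζ'‖ :=
  norm_inner_apply_le _ (norm_rep_le π σ x) ζ ζ'

lemma coeff_tmul (π : CStarRep A) (σ : CStarRep B) (ξ ξ' : π.H) (η η' : σ.H) (a : A) (b : B) :
    coeff π σ (HilbertTensor.tmul ξ η) (HilbertTensor.tmul ξ' η') (tmul a b) =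
      π.coeff ξ ξ' a * σ.coeff η η' b := by
  rw [coeff_apply, rep_tmul, opTensor_tmul, HilbertTensor.inner_tmul]; rfl

/-- The slice map `ω ⊗ id : A ⊗ B → B` of a coefficient functional `ω = ⟪ξ, π(·) ξ'⟫` of `A`. It
is compatible with all representations of `B` at once. -/
lemma exists_slice_right (π : CStarRep A) (ξ ξ' : π.H) :
    ∃ R : SpatialTensor A B →L[ℂ] B, ∀ x (σ : CStarRep B) (η η' : σ.H),
      σ.coeff η η' (R x) = coeff π σ (HilbertTensor.tmul ξ η) (HilbertTensor.tmul ξ' η') x := by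
  refine Exists.imp (fun R hR x σ η η' => hR x ⟨σ, η, η'⟩) (exists_clm_of_forall_apply_eq
    (ι := Σ σ : CStarRep B, σ.H × σ.H)
    (fun i => i.1.coeff i.2.1 i.2.2)
    (fun i => coeff (A := A) π i.1 (HilbertTensor.tmul ξ i.2.1) (HilbertTensor.tmul ξ' i.2.2))
    (‖ξ‖ * ‖ξ'‖) ?_ (Set.range fun p : A × B => tmul p.1 p.2) ?_ ?_)
  · intro x y h
    refine norm_le_of_forall_coeff_le (by positivity) fun σ η η' => ?_
    rw [h ⟨σ, η, η'⟩]
    refine (norm_coeff_le _ _ _ _ _).trans (le_of_eq ?_)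
    rw [HilbertTensor.norm_tmul, HilbertTensor.norm_tmul]; ring
  · exact fun S hS h => eq_top_of_tmul_mem S hS fun a b => h ⟨(a, b), rfl⟩
  · rintro _ ⟨⟨a, b⟩, rfl⟩
    refine ⟨π.coeff ξ ξ' a • b, fun i => ?_⟩
    rw [map_smul, coeff_tmul, smul_eq_mul]

/-- The slice map `id ⊗ ω : A ⊗ B → A` of a coefficient functional `ω = ⟪η, σ(·) η'⟫` of `B`. -/
lemma exists_slice_left (σ : CStarRep B) (η η' : σ.H) :
    ∃ L : SpatialTensor A B →L[ℂ] A, ∀ a b, L (tmul a b) = σ.coeff η η' b • a := by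
  refine Exists.imp (fun L hL a b => eq_of_forall_coeff_eq fun π ξ ξ' => ?_)
    (exists_clm_of_forall_apply_eq
    (ι := Σ π : CStarRep A, π.H × π.H)
    (fun i => i.1.coeff i.2.1 i.2.2)
    (fun i => coeff (B := B) i.1 σ (HilbertTensor.tmul i.2.1 η) (HilbertTensor.tmul i.2.2 η'))
    (‖η‖ * ‖η'‖) ?_ (Set.range fun p : A × B => tmul p.1 p.2) ?_ ?_)
  · rw [hL _ ⟨π, ξ, ξ'⟩, coeff_tmul, map_smul, smul_eq_mul, mul_comm]
  · intro x y h
    refine norm_le_of_forall_coeff_le (by positivity) fun π ξ ξ' => ?_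
    rw [h ⟨π, ξ, ξ'⟩]
    refine (norm_coeff_le _ _ _ _ _).trans (le_of_eq ?_)
    rw [HilbertTensor.norm_tmul, HilbertTensor.norm_tmul]; ring
  · exact fun S hS h => eq_top_of_tmul_mem S hS fun a b => h ⟨(a, b), rfl⟩
  · rintro _ ⟨⟨a, b⟩, rfl⟩
    refine ⟨σ.coeff η η' b • a, fun i => ?_⟩
    rw [map_smul, coeff_tmul, smul_eq_mul, mul_comm]

end SpatialTensor

/-! ### Tensor products with matrix algebras -/

/-- The representation of `M_κ(ℂ)` on `ℂ^κ`. -/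
def CStarRep.matrix (κ : Type v) [Fintype κ] [DecidableEq κ] : CStarRep (CStarMatrix κ κ ℂ) where
  H := EuclideanSpace ℂ κ
  hom :=
    { toFun := fun b => Matrix.toEuclideanCLM (n := κ) (𝕜 := ℂ) (CStarMatrix.ofMatrix.symm b)
      map_smul' := fun c _ => map_smul (Matrix.toEuclideanCLM (n := κ) (𝕜 := ℂ)) c _
      map_zero' := map_zero (Matrix.toEuclideanCLM (n := κ) (𝕜 := ℂ))
      map_add' := fun _ _ => map_add (Matrix.toEuclideanCLM (n := κ) (𝕜 := ℂ)) _ _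
      map_mul' := fun _ _ => map_mul (Matrix.toEuclideanCLM (n := κ) (𝕜 := ℂ)) _ _
      map_star' := fun _ => map_star (Matrix.toEuclideanCLM (n := κ) (𝕜 := ℂ)) _ }

lemma CStarRep.matrix_coeff_single (κ : Type v) [Fintype κ] [DecidableEq κ]
    (p q : κ) (b : CStarMatrix κ κ ℂ) :
    (CStarRep.matrix κ).coeff (EuclideanSpace.single p (1 : ℂ)) (EuclideanSpace.single q (1 : ℂ)) b
      = b p q := by
  change inner ℂ (EuclideanSpace.single p (1 : ℂ)) (Matrix.toEuclideanCLM (n := κ) (𝕜 := ℂ)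
    (CStarMatrix.ofMatrix.symm b) (EuclideanSpace.single q (1 : ℂ))) = _
  rw [EuclideanSpace.inner_single_left]
  simp

namespace SpatialTensor

variable {A : Type u} [NonUnitalCStarAlgebra A] (κ : Type v) [Fintype κ]

/-- `A ⊗ M_κ(ℂ)` embeds into `M_κ(A)`: the entries are the slices by the matrix coefficients. -/
lemma exists_matrix_embedding :
    ∃ f : SpatialTensor A (CStarMatrix κ κ ℂ) →⋆ₙ+* Matrix κ κ A, Function.Injective f := by
  classical
  choose m hm using fun p q : κ => exists_slice_left (A := A) (CStarRep.matrix κ)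
    (EuclideanSpace.single p (1 : ℂ)) (EuclideanSpace.single q (1 : ℂ))
  have hm' (p q a b) : m p q (tmul a b) = b p q • a := by
    rw [hm]; congr 1; exact CStarRep.matrix_coeff_single κ p q b
  have hmul (x y : SpatialTensor A (CStarMatrix κ κ ℂ)) (p q : κ) :
      m p q (x * y) = ∑ r, m p r x * m r q y := by
    have key (a : A) (b : CStarMatrix κ κ ℂ) :
        (m p q).comp (ContinuousLinearMap.mul ℂ _ (tmul a b)) =
          ∑ r, (ContinuousLinearMap.mul ℂ A (m p r (tmul a b))).comp (m r q) := by
      refine ext_tmul fun a' b' => ?_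
      simp [tmul_mul_tmul, hm', CStarMatrix.mul_apply, Finset.sum_smul, mul_smul]
    have key2 : (m p q).comp ((ContinuousLinearMap.mul ℂ _).flip y) =
          ∑ r, ((ContinuousLinearMap.mul ℂ A).flip (m r q y)).comp (m p r) := by
      refine ext_tmul fun a b => ?_
      have := congrArg (fun T => T y) (key a b)
      simpa using this
    have := congrArg (fun T => T x) key2
    simpa using this
  have hstar (x : SpatialTensor A (CStarMatrix κ κ ℂ)) (p q : κ) :
      m p q (star x) = star (m q p x) := by
    have hS : IsClosed {x : SpatialTensor A (CStarMatrix κ κ ℂ) | m p q (star x) =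
        star (m q p x)} :=
      isClosed_eq ((m p q).continuous.comp continuous_star)
        (continuous_star.comp (m q p).continuous)
    have := eq_top_of_tmul_mem
      { carrier := {x : SpatialTensor A (CStarMatrix κ κ ℂ) | m p q (star x) = star (m q p x)}
        zero_mem' := by simp
        add_mem' := fun {x y} hx hy => by
          simp only [Set.mem_ofPred_eq, star_add, map_add] at *; rw [hx, hy]
        smul_mem' := fun c x hx => by
          simp only [Set.mem_ofPred_eq, star_smul, map_smul] at *; rw [hx] } hS
      fun a b => by
        simp only [Submodule.mem_mk, AddSubmonoid.mem_mk, AddSubsemigroup.mem_mk,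
          Set.mem_ofPred_eq, star_tmul, hm', star_smul]
        rfl
    exact (this ▸ Submodule.mem_top : x ∈ _)
  refine ⟨{ toFun := fun x => Matrix.of fun p q => m p q x
            map_zero' := by ext; simp
            map_add' := fun x y => by ext; simp
            map_mul' := fun x y => by ext p q; simp [hmul, Matrix.mul_apply]
            map_star' := fun x => by ext p q; simp [hstar, Matrix.star_apply] }, ?_⟩
  -- the inverse on the image is `(a_pq) ↦ ∑ a_pq ⊗ e_pq`
  have hinv : ∑ p, ∑ q, (tmulRight (CStarMatrix.ofMatrix (Matrix.single p q 1))).comp (m p q) =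
      ContinuousLinearMap.id ℂ (SpatialTensor A (CStarMatrix κ κ ℂ)) := by
    refine ext_tmul fun a b => ?_
    let T : Matrix κ κ ℂ →ₗ[ℂ] SpatialTensor A (CStarMatrix κ κ ℂ) :=
      { toFun := fun b => tmul a (CStarMatrix.ofMatrix b)
        map_add' := fun b b' => tmul_add a _ _
        map_smul' := fun c b => tmul_smul c a _ }
    have hT (b : Matrix κ κ ℂ) : T b = ∑ p, ∑ q, b p q • T (Matrix.single p q 1) := by
      conv_lhs => rw [Matrix.matrix_eq_sum_single b]
      simp only [map_sum, ← map_smul, Matrix.smul_single, smul_eq_mul, mul_one]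
    simp only [sum_apply, ContinuousLinearMap.comp_apply, ContinuousLinearMap.id_apply, hm',
      map_smul]
    exact (hT (CStarMatrix.ofMatrix.symm b)).symm
  intro x y hxy
  have h1 (p q) : m p q x = m p q y := congrFun (congrFun hxy p) q
  have h2 (z) := congrArg (fun T => T z) hinv
  simp only [sum_apply, ContinuousLinearMap.comp_apply, ContinuousLinearMap.id_apply] at h2
  rw [← h2 x, ← h2 y]
  simp only [h1]

lemma isQuasiFinite_matrix (hA : ∀ n : ℕ, IsQuasiFinite (Matrix (Fin n) (Fin n) A)) (n : ℕ) :
    IsQuasiFinite (Matrix (Fin n) (Fin n) (SpatialTensor A (CStarMatrix κ κ ℂ))) := by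
  obtain ⟨f, hf⟩ := exists_matrix_embedding (A := A) κ
  exact (isQuasiFinite_matrix_matrix (isQuasiFinite_matrix_of_fin hA)).of_injective _
    (Matrix.mapNonUnitalStarRingHom_injective (Fin n) hf)

end SpatialTensor

/-! ### Quotients of sequence algebras -/

/-- The underlying homomorphism of ⋆-rings. -/
def NonUnitalStarAlgHom.toNonUnitalStarRingHom {R S : Type*} [NonUnitalCStarAlgebra R]
    [NonUnitalCStarAlgebra S] (f : R →⋆ₙₐ[ℂ] S) : R →⋆ₙ+* S where
  toFun := f
  map_zero' := map_zero f
  map_add' := map_add f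
  map_mul' := map_mul f
  map_star' := map_star f

section MatrixNorm

variable {C : Type*} [NonUnitalCStarAlgebra C] [PartialOrder C] [StarOrderedRing C]
  {n : Type*} [Fintype n] [DecidableEq n]

lemma CStarMatrix.norm_ofMatrix_single_le (p q : n) (c : C) :
    ‖CStarMatrix.ofMatrix (Matrix.single p q c)‖ ≤ ‖c‖ := by
  -- diagonal matrix units give a ⋆-homomorphism, which is contractive
  let f : C →⋆ₙₐ[ℂ] CStarMatrix n n C :=
    { toFun := fun c => CStarMatrix.ofMatrix (Matrix.single q q c)
      map_smul' := fun z c => (Matrix.smul_single z q q c).symm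
      map_zero' := Matrix.single_zero q q
      map_add' := fun c c' => Matrix.single_add q q c c'
      map_mul' := fun c c' => (Matrix.single_mul_single_same ..).symm
      map_star' := fun c => (Matrix.conjTranspose_single q q c).symm }
  have h1 : star (CStarMatrix.ofMatrix (Matrix.single p q c)) *
      CStarMatrix.ofMatrix (Matrix.single p q c) = f (star c * c) := by
    change (Matrix.single p q c).conjTranspose * Matrix.single p q c = _
    rw [Matrix.conjTranspose_single, Matrix.single_mul_single_same]
    rfl
  have h2 := NonUnitalStarAlgHom.norm_apply_le f (star c * c)
  rw [← h1, CStarRing.norm_star_mul_self, CStarRing.norm_star_mul_self] at h2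
  exact abs_le_of_sq_le_sq' (by simpa [sq] using h2) (norm_nonneg c) |>.2

lemma CStarMatrix.norm_le_sum_norm_entry (x : CStarMatrix n n C) :
    ‖x‖ ≤ ∑ p, ∑ q, ‖x p q‖ := by
  have h : x = ∑ p, ∑ q, CStarMatrix.ofMatrix (Matrix.single p q (x p q)) :=
    Matrix.matrix_eq_sum_single (CStarMatrix.ofMatrix.symm x)
  conv_lhs => rw [h]
  refine (norm_sum_le _ _).trans (Finset.sum_le_sum fun p _ => (norm_sum_le _ _).trans
    (Finset.sum_le_sum fun q _ => norm_ofMatrix_single_le p q _))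

end MatrixNorm

/-- The elements whose images under a sequence of ⋆-homomorphisms tend to zero in norm. -/
def tendstoZeroSubmodule {C : Type*} [NonUnitalCStarAlgebra C] {N : ℕ → Type*}
    [∀ i, NonUnitalCStarAlgebra (N i)] (F : ∀ i, C →⋆ₙₐ[ℂ] N i) : Submodule ℂ C where
  carrier := {z | Filter.Tendsto (fun i => ‖F i z‖) Filter.atTop (nhds 0)}
  zero_mem' := by simp
  add_mem' {x y} hx hy := by
    refine squeeze_zero (fun i => norm_nonneg _) (fun i => ?_)
      (by simpa using Filter.Tendsto.add hx hy)
    rw [map_add]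
    exact norm_add_le _ _
  smul_mem' c x hx := by
    have := Filter.Tendsto.const_mul ‖c‖ hx
    simpa [map_smul, norm_smul] using this

lemma isClosed_tendstoZeroSubmodule {C : Type*} [NonUnitalCStarAlgebra C] {N : ℕ → Type*}
    [∀ i, NonUnitalCStarAlgebra (N i)] (F : ∀ i, C →⋆ₙₐ[ℂ] N i) :
    IsClosed (tendstoZeroSubmodule F : Set C) := by
  refine isClosed_of_closure_subset fun x hx => ?_
  change Filter.Tendsto (fun i => ‖F i x‖) Filter.atTop (nhds 0)
  rw [Metric.tendsto_atTop]
  intro ε hε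
  obtain ⟨y, hy, hxy⟩ := Metric.mem_closure_iff.1 hx (ε / 2) (half_pos hε)
  obtain ⟨m, hm⟩ := Metric.tendsto_atTop.1 (show Filter.Tendsto (fun i => ‖F i y‖)
    Filter.atTop (nhds 0) from hy) (ε / 2) (half_pos hε)
  refine ⟨m, fun i hi => ?_⟩
  have h1 := hm i hi
  have h2 := NonUnitalStarAlgHom.norm_apply_le (F i) (x - y)
  have h3 := norm_sub_norm_le (F i x) (F i y)
  rw [map_sub] at h2
  rw [dist_zero_right, norm_norm] at h1 ⊢
  rw [dist_eq_norm] at hxy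
  linarith

namespace SpatialTensor

variable {A : Type u} {J D B : Type v} [NonUnitalCStarAlgebra A] [NonUnitalCStarAlgebra J]
  [NonUnitalCStarAlgebra D] [NonUnitalCStarAlgebra B]
  {N : ℕ → Type v} [∀ i, NonUnitalCStarAlgebra (N i)]

/-- If the norms of `ev i d` tend to zero for every `d` in the range of `ι`, the same holds after
tensoring with `A`. -/
lemma tendsto_norm_map_id (ι : J →⋆ₙₐ[ℂ] D) (ev : ∀ i, D →⋆ₙₐ[ℂ] N i)
    (h : ∀ d, Filter.Tendsto (fun i => ‖ev i (ι d)‖) Filter.atTop (nhds 0))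
    (z : SpatialTensor A J) :
    Filter.Tendsto (fun i => ‖map (NonUnitalStarAlgHom.id ℂ A) (ev i)
      (map (NonUnitalStarAlgHom.id ℂ A) ι z)‖) Filter.atTop (nhds 0) := by
  let F (i : ℕ) : SpatialTensor A J →⋆ₙₐ[ℂ] SpatialTensor A (N i) :=
    (map (NonUnitalStarAlgHom.id ℂ A) (ev i)).comp (map (NonUnitalStarAlgHom.id ℂ A) ι)
  have hmem (a : A) (d : J) : tmul a d ∈ tendstoZeroSubmodule F := by
    have hF (i : ℕ) : F i (tmul a d) = tmul a (ev i (ι d)) := by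
      change map (NonUnitalStarAlgHom.id ℂ A) (ev i) (map (NonUnitalStarAlgHom.id ℂ A) ι _) = _
      rw [map_tmul, map_tmul]
      rfl
    have hbound (i : ℕ) : ‖F i (tmul a d)‖ ≤ ‖a‖ * ‖ev i (ι d)‖ := by
      rw [hF]
      exact norm_tmul_le a (ev i (ι d))
    have h1 := (h d).const_mul ‖a‖
    rw [mul_zero] at h1
    exact squeeze_zero (fun i => norm_nonneg _) hbound h1
  have htop := eq_top_of_tmul_mem _ (isClosed_tendstoZeroSubmodule F) hmem
  have hz : z ∈ tendstoZeroSubmodule F := by rw [htop]; exact Submodule.mem_top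
  exact hz

/-- If `d ∈ D` is killed by `φ` whenever the norms of `ev i d` tend to zero, then the same holds
after tensoring with `A`: the right slices of an element of `A ⊗ D` reduce this to `D` itself. -/
lemma map_id_eq_zero_of_tendsto (φ : D →⋆ₙₐ[ℂ] B) (ev : ∀ i, D →⋆ₙₐ[ℂ] N i)
    (h : ∀ d, Filter.Tendsto (fun i => ‖ev i d‖) Filter.atTop (nhds 0) → φ d = 0)
    (y : SpatialTensor A D)
    (hy : Filter.Tendsto (fun i => ‖map (NonUnitalStarAlgHom.id ℂ A) (ev i) y‖)
      Filter.atTop (nhds 0)) :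
    map (NonUnitalStarAlgHom.id ℂ A) φ y = 0 := by
  refine ext_rep fun π σ => HilbertTensor.ext_inner_tmul fun ξ η ξ' η' => ?_
  obtain ⟨R, hR⟩ := exists_slice_right (B := D) π ξ ξ'
  have hRy : φ (R y) = 0 := by
    refine h _ (squeeze_zero (fun i => norm_nonneg _) (fun i => ?_)
      (show Filter.Tendsto (fun i => ‖map (NonUnitalStarAlgHom.id ℂ A) (ev i) y‖ * (‖ξ‖ * ‖ξ'‖))
        Filter.atTop (nhds 0) by simpa using hy.mul_const (‖ξ‖ * ‖ξ'‖)))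
    refine norm_le_of_forall_coeff_le (by positivity) fun τ k k' => ?_
    have h1 : τ.coeff k k' (ev i (R y)) =
        coeff π τ (HilbertTensor.tmul ξ k) (HilbertTensor.tmul ξ' k')
          (map (NonUnitalStarAlgHom.id ℂ A) (ev i) y) := hR y (τ.comp (ev i)) k k'
    rw [h1]
    refine (norm_coeff_le _ _ _ _ _).trans_eq ?_
    rw [HilbertTensor.norm_tmul, HilbertTensor.norm_tmul]; ring
  have h2 : coeff π σ (HilbertTensor.tmul ξ η) (HilbertTensor.tmul ξ' η')
      (map (NonUnitalStarAlgHom.id ℂ A) φ y) = σ.coeff η η' (φ (R y)) :=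
    (hR y (σ.comp φ) η η').symm
  rw [hRy, map_zero, coeff_apply] at h2
  rw [h2, map_zero]
  simp

/-- Stable finiteness of `A ⊗ B` when `B` is the quotient of a C⋆-algebra `D` of "sequences"
`(ev i d)_i` by the ideal `J` of null sequences, `A ⊗ -` preserves this extension, and all
matrix algebras over `A ⊗ N i` are quasi-finite. -/
theorem isStablyFinite_of_exact (ι : J →⋆ₙₐ[ℂ] D) (φ : D →⋆ₙₐ[ℂ] B)
    (hexact : Function.Exact (map (NonUnitalStarAlgHom.id ℂ A) ι)
      (map (NonUnitalStarAlgHom.id ℂ A) φ))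
    (hsurj : Function.Surjective (map (NonUnitalStarAlgHom.id ℂ A) φ))
    (ev : ∀ i, D →⋆ₙₐ[ℂ] N i)
    (hι : ∀ d, Filter.Tendsto (fun i => ‖ev i (ι d)‖) Filter.atTop (nhds 0))
    (hφ : ∀ d, Filter.Tendsto (fun i => ‖ev i d‖) Filter.atTop (nhds 0) → φ d = 0)
    (hN : ∀ i n, IsQuasiFinite (Matrix (Fin n) (Fin n) (SpatialTensor A (N i)))) :
    IsStablyFinite (SpatialTensor A B) := by
  refine isStablyFinite_of_isQuasiFinite fun n X hX => ?_
  let _ (i : ℕ) : PartialOrder (SpatialTensor A (N i)) := CStarAlgebra.spectralOrder _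
  have _ (i : ℕ) : StarOrderedRing (SpatialTensor A (N i)) := CStarAlgebra.spectralOrderedRing _
  let Φ : SpatialTensor A D →⋆ₙ+* SpatialTensor A B :=
    (map (NonUnitalStarAlgHom.id ℂ A) φ).toNonUnitalStarRingHom
  let E (i : ℕ) : SpatialTensor A D →⋆ₙ+* SpatialTensor A (N i) :=
    (map (NonUnitalStarAlgHom.id ℂ A) (ev i)).toNonUnitalStarRingHom
  let F := Matrix.mapNonUnitalStarRingHom (Fin n) Φ
  let G (i : ℕ) : Matrix (Fin n) (Fin n) (SpatialTensor A D) →⋆ₙ+*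
      CStarMatrix (Fin n) (Fin n) (SpatialTensor A (N i)) :=
    Matrix.mapNonUnitalStarRingHom (Fin n) (E i)
  have hG (i) (Z) (p q : Fin n) : G i Z p q = E i (Z p q) := rfl
  choose Y hY using fun p q => hsurj (X p q)
  have hFY : F (Matrix.of Y) = X := Matrix.ext fun p q => hY p q
  have hlim : Filter.Tendsto (fun i => ‖G i (Matrix.of Y + star (Matrix.of Y) +
      star (Matrix.of Y) * Matrix.of Y)‖) Filter.atTop (nhds 0) := by
    refine squeeze_zero (fun i => norm_nonneg _)
      (fun i => CStarMatrix.norm_le_sum_norm_entry _) ?_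
    rw [show (0 : ℝ) = ∑ p : Fin n, ∑ q : Fin n, 0 by simp]
    refine tendsto_finsetSum _ fun p _ => tendsto_finsetSum _ fun q _ => ?_
    have h0 : F (Matrix.of Y + star (Matrix.of Y) + star (Matrix.of Y) * Matrix.of Y) = 0 := by
      rw [map_add, map_add, map_mul, map_star, hFY, hX]
    obtain ⟨z, hz⟩ := (hexact _).1 (congrFun (congrFun h0 p) q)
    simp only [hG, ← hz]
    exact tendsto_norm_map_id ι ev hι z
  have hlim' : Filter.Tendsto (fun i => ‖G i (Matrix.of Y + star (Matrix.of Y) +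
      Matrix.of Y * star (Matrix.of Y))‖) Filter.atTop (nhds 0) := by
    refine squeeze_zero' (Filter.Eventually.of_forall fun i => norm_nonneg _) ?_ hlim
    filter_upwards [hlim.eventually (ge_mem_nhds (by norm_num : (0 : ℝ) < 1 / 2))] with i hi
    have hC : IsQuasiFinite (CStarMatrix (Fin n) (Fin n) (SpatialTensor A (N i))) := hN i n
    simp only [map_add, map_mul, map_star] at hi ⊢
    exact hC.norm_add_star_add_mul_star_le hi
  have h0 : F (Matrix.of Y + star (Matrix.of Y) + Matrix.of Y * star (Matrix.of Y)) = 0 := by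
    refine Matrix.ext fun p q => ?_
    refine map_id_eq_zero_of_tendsto φ ev hφ _
      (squeeze_zero (fun i => norm_nonneg _) (fun i => ?_) hlim')
    exact CStarMatrix.norm_entry_le_norm (M := G i _) (i := p) (j := q)
  rw [map_add, map_add, map_mul, map_star, hFY] at h0
  exact h0

end SpatialTensor

/-! ### The extension of an MF algebra by null sequences -/

section Pullback

variable {B : Type v} [NonUnitalCStarAlgebra B] {M : ℕ → Type} [∀ i, NonUnitalCStarAlgebra (M i)]

lemma SeqQuotient.continuous_mk : Continuous (SeqQuotient.mk M) :=
  AddMonoidHomClass.continuous_of_bound _ 1 fun a => by simpa using SeqQuotient.norm_mk_le a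

/-- The pullback of `j : B → ∏ M_i / ⨁ M_i` along the quotient map: the pairs `(b, x)` such that
the bounded sequence `x` represents `j b`. For injective `j` it is a copy of the preimage of `j B`
in `∏ M_i`; keeping the coordinate `b` places it in the universe of `B`. -/
def seqPullback (j : B →⋆ₙₐ[ℂ] SeqQuotient M) : NonUnitalStarSubalgebra ℂ (B × lp M ∞) where
  carrier := {p | j p.1 = SeqQuotient.mk M p.2}
  zero_mem' := by simp
  add_mem' {p q} hp hq := by
    change j (p.1 + q.1) = SeqQuotient.mk M (p.2 + q.2)
    rw [map_add, map_add, show j p.1 = _ from hp, show j q.1 = _ from hq]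
  mul_mem' {p q} hp hq := by
    change j (p.1 * q.1) = SeqQuotient.mk M (p.2 * q.2)
    rw [map_mul, SeqQuotient.mk_mul, show j p.1 = _ from hp, show j q.1 = _ from hq]
  smul_mem' c p hp := by
    change j (c • p.1) = SeqQuotient.mk M (c • p.2)
    rw [map_smul, map_smul, show j p.1 = _ from hp]
  star_mem' {p} hp := by
    change j (star p.1) = SeqQuotient.mk M (star p.2)
    rw [map_star, SeqQuotient.mk_star, show j p.1 = _ from hp]

instance (j : B →⋆ₙₐ[ℂ] SeqQuotient M) : NonUnitalCStarAlgebra (seqPullback j) :=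
  NonUnitalStarSubalgebra.nonUnitalCStarAlgebra (seqPullback j) (h_closed :=
    isClosed_eq ((AddMonoidHomClass.continuous_of_bound j 1 fun b => by
      simpa using NonUnitalStarAlgHom.norm_apply_le j b).comp continuous_fst)
      (SeqQuotient.continuous_mk.comp continuous_snd))

variable (B M) in
/-- The ideal `0 × ⨁ M_i` of null sequences. -/
def nullPairs : NonUnitalStarSubalgebra ℂ (B × lp M ∞) where
  carrier := {p | p.1 = 0 ∧ p.2 ∈ nullSeq M}
  zero_mem' := ⟨rfl, zero_mem _⟩
  add_mem' {p q} hp hq := ⟨by simp [hp.1, hq.1], add_mem hp.2 hq.2⟩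
  mul_mem' {p q} hp hq := ⟨by simp [hp.1], nullSeq_mul_left p.2 hq.2⟩
  smul_mem' c p hp := ⟨by simp [hp.1], (nullSeq M).smul_mem c hp.2⟩
  star_mem' {p} hp := ⟨by simp [hp.1], nullSeq_star hp.2⟩

instance : NonUnitalCStarAlgebra (nullPairs B M) :=
  NonUnitalStarSubalgebra.nonUnitalCStarAlgebra (nullPairs B M) (h_closed :=
    (isClosed_singleton.preimage continuous_fst).inter
      ((nullSeq_isClosed (M := M)).preimage continuous_snd))

lemma nullPairs_le_seqPullback (j : B →⋆ₙₐ[ℂ] SeqQuotient M) : nullPairs B M ≤ seqPullback j := by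
  rintro p ⟨h1, h2⟩
  change j p.1 = SeqQuotient.mk M p.2
  rw [h1, map_zero, ← map_zero (SeqQuotient.mk M), SeqQuotient.mk_eq_mk, zero_sub]
  exact neg_mem h2

/-- The projection of the pullback onto `B`. -/
def seqPullbackFst (j : B →⋆ₙₐ[ℂ] SeqQuotient M) : seqPullback j →⋆ₙₐ[ℂ] B :=
  (NonUnitalStarAlgHom.fst ℂ B (lp M ∞)).comp (NonUnitalStarSubalgebraClass.subtype (seqPullback j))

lemma seqPullbackFst_surjective (j : B →⋆ₙₐ[ℂ] SeqQuotient M) :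
    Function.Surjective (seqPullbackFst j) := by
  intro b
  obtain ⟨x, hx⟩ := SeqQuotient.mk_surjective (j b)
  exact ⟨⟨(b, x), hx.symm⟩, rfl⟩

lemma exact_seqPullback (j : B →⋆ₙₐ[ℂ] SeqQuotient M) :
    Function.Exact (NonUnitalStarSubalgebra.inclusion (nullPairs_le_seqPullback j))
      (seqPullbackFst j) := by
  intro p
  constructor
  · intro hp
    have h1 : p.1.1 = 0 := hp
    have h2 : j p.1.1 = SeqQuotient.mk M p.1.2 := p.2
    rw [h1, map_zero, ← map_zero (SeqQuotient.mk M), eq_comm, SeqQuotient.mk_eq_mk, sub_zero] at h2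
    exact ⟨⟨p.1, h1, h2⟩, rfl⟩
  · rintro ⟨q, rfl⟩
    exact q.2.1

/-- The `i`-th term of the sequence, followed by a homomorphism `e : M_i → N`. -/
def seqPullbackEval (j : B →⋆ₙₐ[ℂ] SeqQuotient M) {N : Type v} [NonUnitalCStarAlgebra N] (i : ℕ)
    (e : M i →⋆ₙₐ[ℂ] N) : seqPullback j →⋆ₙₐ[ℂ] N where
  toFun p := e (p.1.2 i)
  map_smul' c p := map_smul e c (p.1.2 i)
  map_zero' := map_zero e
  map_add' p q := map_add e (p.1.2 i) (q.1.2 i)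
  map_mul' p q := map_mul e (p.1.2 i) (q.1.2 i)
  map_star' p := map_star e (p.1.2 i)

end Pullback

/-- The copy of `M_k(ℂ)` in a given universe, with index type lifted to that universe. -/
def CStarMatrix.uliftHom (k : ℕ) : CStarMatrix (Fin k) (Fin k) ℂ →⋆ₙₐ[ℂ]
    CStarMatrix (ULift.{v} (Fin k)) (ULift.{v} (Fin k)) ℂ :=
  NonUnitalStarAlgHomClass.toNonUnitalStarAlgHom
    (CStarMatrix.reindexₐ ℂ ℂ (Equiv.ulift.symm : Fin k ≃ ULift.{v} (Fin k)))

end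

theorem lemma3p1 (A : Type u) (B : Type v) [NonUnitalCStarAlgebra A] [NonUnitalCStarAlgebra B]
    (hAexact : IsExactCStar.{u, v} A) (hAfinite : IsStablyFinite A)
    (hBsep : TopologicalSpace.SeparableSpace B) (hBMF : IsMF B) :
    IsStablyFinite (SpatialTensor A B) := by
  obtain ⟨k, j, hj⟩ := hBMF
  obtain ⟨-, hexact, hsurj⟩ := hAexact (nullPairs B _) (seqPullback j) B
    (NonUnitalStarSubalgebra.inclusion (nullPairs_le_seqPullback j)) (seqPullbackFst j)
    (Set.inclusion_injective (nullPairs_le_seqPullback j)) (exact_seqPullback j)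
    (seqPullbackFst_surjective j)
  have hnorm (i : ℕ) (x : CStarMatrix (Fin (k i)) (Fin (k i)) ℂ) :
      ‖CStarMatrix.uliftHom.{v} (k i) x‖ = ‖x‖ :=
    NonUnitalStarAlgHom.norm_map (CStarMatrix.uliftHom.{v} (k i)) (EquivLike.injective
      (CStarMatrix.reindexₐ ℂ ℂ (Equiv.ulift.symm : Fin (k i) ≃ ULift.{v} (Fin (k i))))) x
  refine SpatialTensor.isStablyFinite_of_exact
    (N := fun i => CStarMatrix (ULift.{v} (Fin (k i))) (ULift.{v} (Fin (k i))) ℂ)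
    _ _ hexact hsurj (fun i => seqPullbackEval j i (CStarMatrix.uliftHom (k i))) ?_ ?_ ?_
  · intro d
    refine Filter.Tendsto.congr (fun i => (hnorm i _).symm) ?_
    exact d.2.2
  · intro d hd
    have h1 : d.1.2 ∈ nullSeq _ := Filter.Tendsto.congr (fun i => hnorm i _) hd
    have h2 : j d.1.1 = SeqQuotient.mk _ d.1.2 := d.2
    rw [← sub_zero d.1.2, ← SeqQuotient.mk_eq_mk, map_zero] at h1
    exact hj (h2.trans (h1.trans (map_zero j).symm))
  · exact fun i n => SpatialTensor.isQuasiFinite_matrix _ hAfinite.isQuasiFinite_matrix n
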